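/- Let $k\ge 1$ and $N\ge 1$ be integers and let $q\in\mathbb C$ with $|q|<1$. Write $(q)_n=\prod_{i=1}^n(1-q^i)$, $(q)_\infty=\prod_{i\ge1}(1-q^i)$, and ${A\brack B}=\frac{(q)_A}{(q)_B(q)_{A-B}}$ if $0\le B\le A$ and ${A\brack B}=0$ otherwise. Let $\mathcal I$ with $\mathcal I_{i,j}=\delta_{i,j-1}+\delta_{i,j+1}$ be the incidence matrix and $C=2I-\mathcal I$ the Cartan matrix of the Lie algebra $A_{N-1}$ (both of size $(N-1)\times(N-1)$), and let $(\vec e_\ell)_j=\delta_{\ell,j}$ for $1\le j\le N-1$. A sum $\sum_{A-(C^{-1}\vec v)_1\in\mathbb Z}$ runs over all vectors $\vec v$ of $N-1$ non-negative integers for which $A-(C^{-1}\vec v)_1$ is an integer; for $N=1$ it consists of the empty vector only. Fractional powers of $q$ are taken with the principal branch (all total exponents occurring below are integers). Then $$\frac{1}{(q)_\infty}\sum_{j=-\infty}^{\infty}(-1)^j q^{((2k+1+2/N)j+1)j/2}\sum_{\frac jN-(C^{-1}\vec\eta)_1\in\mathbb Z}\frac{q^{\vec\eta\,C^{-1}\vec\eta}}{(q)_{\eta_1}\cdots(q)_{\eta_{N-1}}}$$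 $$=\sum_{r_1\ge\cdots\ge r_k\ge0}\frac{q^{r_1^2/N+r_2^2+\cdots+r_k^2}}{(q)_{r_1-r_2}\cdots(q)_{r_{k-1}-r_k}(q)_{r_k}}\sum_{\frac{r_1}N-(C^{-1}\vec n)_1\in\mathbb Z}q^{\vec n\,C^{-1}\vec n}\prod_{j=1}^{N-1}{m_j+n_j\brack n_j},$$ where $\vec m$ is determined by $\vec n$ and $r_1$ through $\vec m+\vec n=\frac12\left(\mathcal I\,\vec m+2r_1\vec e_{N-1}\right)$, and the double series over $(j,\vec\eta)$ and over $((r_1,\dots,r_k),\vec n)$ converge absolutely. -/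

import Mathlib

namespace HigherBailey

noncomputable section

/-- `(q)_n = (1 - q)(1 - q ^ 2) ⋯ (1 - q ^ n)`. -/
def qPoch (q : ℂ) (n : ℕ) : ℂ := ∏ i ∈ Finset.range n, (1 - q ^ (i + 1))

/-- `(q)_∞ = ∏_{i ≥ 1} (1 - q ^ i)`, a convergent product for `‖q‖ < 1`. -/
def qPochInf (q : ℂ) : ℂ := ∏' i : ℕ, (1 - q ^ (i + 1))

/-- The Gaussian binomial coefficient, `(q)_A / ((q)_B (q)_{A-B})` if `B ≤ A`, and `0` otherwise. -/
def qBinom (q : ℂ) (A B : ℕ) : ℂ :=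
  if B ≤ A then qPoch q A / (qPoch q B * qPoch q (A - B)) else 0

/-- The power `q ^ x` with a rational exponent (principal branch). -/
def qPow (q : ℂ) (x : ℚ) : ℂ := q ^ (x : ℂ)

/-- Integer vectors read as rational vectors. -/
def toRat {d : ℕ} (v : Fin d → ℕ) : Fin d → ℚ := fun i => (v i : ℚ)

/-- The incidence matrix of the Lie algebra `A_{N-1}`: `ℐ_{j,k} = δ_{j,k-1} + δ_{j,k+1}`.
The index `i : Fin (N - 1)` stands for the label `i + 1 ∈ {1, …, N - 1}`. -/
def incidence (N : ℕ) : Matrix (Fin (N - 1)) (Fin (N - 1)) ℚ :=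
  Matrix.of fun i j =>
    (if (i : ℕ) + 1 = j then 1 else 0) + (if (i : ℕ) = (j : ℕ) + 1 then 1 else 0)

/-- The Cartan matrix of the Lie algebra `A_{N-1}`, over `ℚ`. -/
def cartan (N : ℕ) : Matrix (Fin (N - 1)) (Fin (N - 1)) ℚ :=
  (CartanMatrix.A (N - 1)).map (Int.cast : ℤ → ℚ)

/-- The defining relation `C = 2 I - ℐ`. -/
theorem cartan_eq (N : ℕ) : cartan N = (2 : ℚ) • (1 : Matrix _ _ ℚ) - incidence N := by
  ext i j
  simp only [cartan, incidence, CartanMatrix.A, Matrix.map_apply, Matrix.of_apply,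
    Matrix.sub_apply, Matrix.smul_apply, Matrix.one_apply, Fin.ext_iff, smul_eq_mul]
  split_ifs <;> first | (exfalso; omega) | norm_num

/-- The vector `e_ℓ` with components `(e_ℓ)_j = δ_{ℓ,j}`, for labels `j = 1, …, N - 1`. -/
def unitVec (N l : ℕ) : Fin (N - 1) → ℚ := fun i => if (i : ℕ) + 1 = l then 1 else 0

/-- The quadratic form `v C⁻¹ v`. -/
def quadForm (N : ℕ) (v : Fin (N - 1) → ℕ) : ℚ :=
  toRat v ⬝ᵥ ((cartan N)⁻¹).mulVec (toRat v)

/-- The condition `A / N - (C⁻¹ v)_1 ∈ ℤ`, the first component of `C⁻¹ v` being written as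
`e_1 C⁻¹ v` (an empty sum for `N = 1`, where the condition is void). -/
def IntegralShift (N : ℕ) (A : ℤ) (v : Fin (N - 1) → ℕ) : Prop :=
  ∃ z : ℤ, (A : ℚ) / N - unitVec N 1 ⬝ᵥ ((cartan N)⁻¹).mulVec (toRat v) = z

/-- The `(m, n)`-system `m + n = (ℐ m + 2 L e_{N-1}) / 2`. -/
def MNSystem (N L : ℕ) (m n : Fin (N - 1) → ℕ) : Prop :=
  toRat m + toRat n =
    (1 / 2 : ℚ) • ((incidence N).mulVec (toRat m) + (2 * L : ℚ) • unitVec N (N - 1))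

/-- The index set of the inner sum on the left. -/
def EtaIndex (N : ℕ) (j : ℤ) : Type :=
  {η : Fin (N - 1) → ℕ // IntegralShift N j η}

/-- The index set of the inner sum on the right: vectors `n` subject to the integrality condition,
with the companion vector `m` that the `(m, n)`-system attaches to `n`. As `C = 2 I - ℐ` is
invertible, `n` determines `m`. If the solution `m` has a negative component, the product of
Gaussian binomials for `n` is zero, and `n` is left out. -/
def MNIndex (N L : ℕ) : Type :=
  {p : (Fin (N - 1) → ℕ) × (Fin (N - 1) → ℕ) // IntegralShift N L p.2 ∧ MNSystem N L p.1 p.2}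

/-- The index set of the outer sum on the right: `r_1 ≥ … ≥ r_k ≥ 0`. -/
def RIndex (k : ℕ) : Type := {r : Fin k → ℕ // Antitone r}

/-- `part r i` is `r_i` for the labels `i = 1, …, k`, and `part r (k + 1) = 0`. -/
def part {k : ℕ} (r : RIndex k) (i : ℕ) : ℕ :=
  if h : i - 1 < k then r.1 ⟨i - 1, h⟩ else 0

/-- `(-1) ^ j q ^ (((2k + 1 + 2/N) j + 1) j / 2)`. -/
def outerLeft (q : ℂ) (k N : ℕ) (j : ℤ) : ℂ :=
  (-1) ^ j * qPow q (((2 * k + 1 + 2 / N) * j + 1) * j / 2)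

/-- `q ^ (η C⁻¹ η) / ((q)_{η_1} ⋯ (q)_{η_{N-1}})`. -/
def innerLeft (q : ℂ) (N : ℕ) (η : Fin (N - 1) → ℕ) : ℂ :=
  qPow q (quadForm N η) / ∏ i, qPoch q (η i)

/-- `q ^ (r_1² / N + r_2² + ⋯ + r_k²) / ((q)_{r_1 - r_2} ⋯ (q)_{r_{k-1} - r_k} (q)_{r_k})`. -/
def outerRight (q : ℂ) (k N : ℕ) (r : RIndex k) : ℂ :=
  qPow q ((part r 1 : ℚ) ^ 2 / N + ∑ i ∈ Finset.Icc 2 k, (part r i : ℚ) ^ 2) /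
    ∏ i ∈ Finset.Icc 1 k, qPoch q (part r i - part r (i + 1))

/-- `q ^ (n C⁻¹ n) ∏_j [m_j + n_j, n_j]`. -/
def innerRight (q : ℂ) (N : ℕ) (m n : Fin (N - 1) → ℕ) : ℂ :=
  qPow q (quadForm N n) * ∏ i, qBinom q (m i + n i) (n i)

end

end HigherBailey

/-! The identity is Bailey's transform `∑ α_j γ_j = ∑ β_r δ_r`, applied to a Bailey pair `(α, β)`
relative to `1` and a conjugate Bailey pair `(γ, δ)` of level `N`.

The inner sums become sums over integer paths `0 = K_0, K_1, …, K_N = L`. If `v` is the vector of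
second differences of `K`, then `C⁻¹ v` is the chord minus the path, so `v C⁻¹ v = ∑ (K_{i+1} -
K_i)² - L²/N`, and the integrality condition says that `K_1` is an integer. The factor `q^(L²/N)`
(`L = j` or `L = r_1`) supplies the missing fractional power. On the left `η` is the second
difference of a convex path; on the right `m = 2K`, and the vertex factor is a Gaussian binomial
`[K_{i-1} + K_{i+1}, 2 K_i]`. Both inner sums are therefore transfer-matrix sums `stepWeight` with
Gaussian steps, differing only in the vertex weight: `etaKer` for `γ`, `binKer` for `δ`.

The heart is the conjugate pair `γ_l = ∑_r δ_r / ((q)_{r-l} (q)_{r+l})`. It is proved for a finite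
version `boundedGamma`, with `1/(q)_{r+l}` replaced by a Gaussian binomial with an extra parameter
`n`. The exchange identity `tsum_bailey_kernel`, which combines two `q`-Vandermonde sums, trades one
vertex of type `binKer` for one of type `etaKer`; iterating it (`boundedGamma_succ`,
`boundedGamma_eq`) and letting `n → ∞` gives `conjugate_bailey_pair`.

The Bailey pair arises from the unit pair (`tsum_chainAlpha_zero`) by `k` steps of the Bailey chain,
each multiplying `α_j` by `q^(j²)` (`tsum_recPoch_three`, `chainBeta_eq`). Unrolling `β` yields the
sum over `r_2, …, r_k`. All interchanges of sums rest on Gaussian decay. For `q = 0` both sides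
reduce to a single term. -/

namespace HigherBailey

noncomputable section

open Filter Topology

/-! ### Reciprocal `q`-factorials and Gaussian binomials with integer arguments -/

/-- `1 / (q)_n`, extended by `0` to negative `n`. -/
def recPoch (q : ℂ) (n : ℤ) : ℂ := if 0 ≤ n then (qPoch q n.toNat)⁻¹ else 0

/-- The Gaussian binomial coefficient `(1 - q^n) ⋯ (1 - q^(n-k+1)) / (q)_k` for integer `n`, `k`. -/
def gauss (q : ℂ) (n k : ℤ) : ℂ :=
  (∏ i ∈ Finset.range k.toNat, (1 - q ^ (n - i))) * recPoch q k

theorem recPoch_neg (q : ℂ) {n : ℤ} (h : n < 0) : recPoch q n = 0 := by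
  simp [recPoch, not_le.mpr h]

@[simp] theorem recPoch_zero (q : ℂ) : recPoch q 0 = 1 := by simp [recPoch, qPoch]

theorem recPoch_natCast (q : ℂ) (n : ℕ) : recPoch q n = (qPoch q n)⁻¹ := by simp [recPoch]

theorem one_sub_pow_ne_zero {q : ℂ} (hq : ‖q‖ < 1) (i : ℕ) : 1 - q ^ (i + 1) ≠ 0 := by
  intro h
  have h1 : ‖q ^ (i + 1)‖ = 1 := by rw [← sub_eq_zero.mp h, norm_one]
  rw [norm_pow] at h1
  exact absurd h1 (pow_lt_one₀ (norm_nonneg _) hq (by omega)).ne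

theorem qPoch_ne_zero {q : ℂ} (hq : ‖q‖ < 1) (n : ℕ) : qPoch q n ≠ 0 :=
  Finset.prod_ne_zero_iff.mpr fun i _ => one_sub_pow_ne_zero hq i

theorem recPoch_ne_zero {q : ℂ} (hq : ‖q‖ < 1) {n : ℤ} (hn : 0 ≤ n) : recPoch q n ≠ 0 := by
  simp [recPoch, hn, qPoch_ne_zero hq]

theorem recPoch_mul_one_sub {q : ℂ} (hq : ‖q‖ < 1) (n : ℤ) :
    recPoch q n * (1 - q ^ n) = recPoch q (n - 1) := by
  rcases lt_trichotomy n 0 with h | rfl | h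
  · rw [recPoch_neg q h, recPoch_neg q (by omega), zero_mul]
  · rw [recPoch_neg q (by omega : (0 : ℤ) - 1 < 0)]; simp
  · obtain ⟨m, rfl⟩ : ∃ m : ℕ, n = m + 1 := ⟨(n - 1).toNat, by omega⟩
    have h1 := one_sub_pow_ne_zero hq m
    rw [add_sub_cancel_right, recPoch_natCast, ← Nat.cast_succ, recPoch_natCast, zpow_natCast, qPoch,
      qPoch, Finset.prod_range_succ, mul_inv, mul_assoc, Nat.succ_eq_add_one, inv_mul_cancel₀ h1,
      mul_one]

theorem prod_mul_recPoch {q : ℂ} (hq : ‖q‖ < 1) (n : ℤ) (k : ℕ) :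
    (∏ i ∈ Finset.range k, (1 - q ^ (n - i))) * recPoch q n = recPoch q (n - k) := by
  induction k with
  | zero => simp
  | succ k ih =>
    rw [Finset.prod_range_succ, mul_right_comm, ih, recPoch_mul_one_sub hq]
    congr 1; push_cast; ring

theorem gauss_neg (q : ℂ) (n : ℤ) {k : ℤ} (h : k < 0) : gauss q n k = 0 := by
  simp [gauss, recPoch_neg q h]

@[simp] theorem gauss_zero_right (q : ℂ) (n : ℤ) : gauss q n 0 = 1 := by simp [gauss]

theorem gauss_mul_recPoch {q : ℂ} (hq : ‖q‖ < 1) (n k : ℤ) :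
    gauss q n k * recPoch q n = recPoch q k * recPoch q (n - k) := by
  rcases lt_or_ge k 0 with h | h
  · rw [gauss_neg q n h, recPoch_neg q h, zero_mul, zero_mul]
  · obtain ⟨m, rfl⟩ := Int.eq_ofNat_of_zero_le h
    rw [gauss, mul_right_comm, Int.toNat_natCast, prod_mul_recPoch hq, mul_comm]

theorem gauss_of_lt {q : ℂ} (hq : ‖q‖ < 1) {n k : ℤ} (hn : 0 ≤ n) (h : n < k) :
    gauss q n k = 0 := by
  have := gauss_mul_recPoch hq n k
  rw [recPoch_neg q (by omega : n - k < 0), mul_zero] at this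
  exact (mul_eq_zero.mp this).resolve_right (recPoch_ne_zero hq hn)

theorem gauss_zero_left {q : ℂ} (hq : ‖q‖ < 1) {k : ℤ} (hk : k ≠ 0) : gauss q 0 k = 0 := by
  rcases lt_or_gt_of_ne hk with h | h
  · exact gauss_neg q 0 h
  · exact gauss_of_lt hq le_rfl h

theorem gauss_natCast {q : ℂ} (hq : ‖q‖ < 1) (n k : ℕ) : gauss q n k = qBinom q n k := by
  rcases lt_or_ge n k with h | h
  · rw [gauss_of_lt hq (by omega) (by omega), qBinom, if_neg (by omega)]
  · have := gauss_mul_recPoch hq n k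
    rw [← Nat.cast_sub h, recPoch_natCast, recPoch_natCast, recPoch_natCast] at this
    rw [qBinom, if_pos h, div_eq_mul_inv, mul_inv, ← this]
    field_simp [qPoch_ne_zero hq n]

theorem prod_shift_one (q : ℂ) (n : ℤ) (k : ℕ) :
    ∏ i ∈ Finset.range (k + 1), (1 - q ^ (n - i)) =
      (1 - q ^ n) * ∏ i ∈ Finset.range k, (1 - q ^ (n - 1 - i)) := by
  rw [Finset.prod_range_succ', mul_comm]
  congr 1
  · simp
  · refine Finset.prod_congr rfl fun i _ => ?_
    congr 2; push_cast; ring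

/-- For `k > 0` all terms share a product of `k - 1` factors, and what remains is `1 - q^n = q^k (1
- q^(n-k)) + (1 - q^k)`. The sign of `n` plays no role. -/
theorem gauss_pascal {q : ℂ} (hq0 : q ≠ 0) (hq : ‖q‖ < 1) (n k : ℤ) :
    gauss q n k = q ^ k * gauss q (n - 1) k + gauss q (n - 1) (k - 1) := by
  rcases lt_trichotomy k 0 with h | rfl | h
  · simp [gauss_neg q _ h, gauss_neg q _ (by omega : k - 1 < 0)]
  · simp [gauss_neg q _ (by omega : (-1 : ℤ) < 0)]
  · obtain ⟨m, rfl⟩ : ∃ m : ℕ, k = m + 1 := ⟨(k - 1).toNat, by omega⟩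
    have h1 : ((m : ℤ) + 1).toNat = m + 1 := by omega
    have h2 : ((m : ℤ) + 1 - 1).toNat = m := by omega
    have h3 : q ^ n = q ^ ((m : ℤ) + 1) * q ^ (n - 1 - m) := by
      rw [← zpow_add₀ hq0]; congr 1; ring
    rw [gauss, gauss, gauss, h1, h2, prod_shift_one, Finset.prod_range_succ,
      ← recPoch_mul_one_sub hq, h3]
    ring

/-! ### Bounds -/

theorem tendsto_qPoch {q : ℂ} (hq : ‖q‖ < 1) :
    Tendsto (qPoch q) atTop (𝓝 (qPochInf q)) :=
  (ModularForm.multipliable_one_sub_pow hq).hasProd.tendsto_prod_nat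

theorem qPochInf_ne_zero {q : ℂ} (hq : ‖q‖ < 1) : qPochInf q ≠ 0 := by
  have h := tprod_one_add_ne_zero_of_summable (f := fun n : ℕ => -q ^ (n + 1))
    (fun i => by simpa [sub_eq_add_neg] using one_sub_pow_ne_zero hq i)
    (by simpa using (summable_nat_add_iff 1).mpr (summable_geometric_of_lt_one (norm_nonneg _) hq))
  simpa [qPochInf, sub_eq_add_neg] using h

theorem tendsto_recPoch {q : ℂ} (hq : ‖q‖ < 1) :
    Tendsto (recPoch q) atTop (𝓝 (qPochInf q)⁻¹) := by
  have h1 : Tendsto (fun n : ℤ => (qPoch q n.toNat)⁻¹) atTop (𝓝 (qPochInf q)⁻¹) := by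
    refine ((tendsto_qPoch hq).inv₀ (qPochInf_ne_zero hq)).comp ?_
    exact tendsto_atTop_atTop.mpr fun b => ⟨b, fun a ha => by omega⟩
  refine h1.congr' ?_
  filter_upwards [eventually_ge_atTop 0] with n hn
  simp [recPoch, hn]

theorem exists_norm_qPoch_le {q : ℂ} (hq : ‖q‖ < 1) :
    ∃ C : ℝ, 1 ≤ C ∧ (∀ n, ‖qPoch q n‖ ≤ C) ∧ ∀ n, ‖recPoch q n‖ ≤ C := by
  obtain ⟨A, hA⟩ := (tendsto_qPoch hq).norm.bddAbove_range
  obtain ⟨B, hB⟩ := ((tendsto_qPoch hq).inv₀ (qPochInf_ne_zero hq)).norm.bddAbove_range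
  have hA' : ∀ n, ‖qPoch q n‖ ≤ A := fun n => hA ⟨n, rfl⟩
  have hB' : ∀ n, ‖(qPoch q n)⁻¹‖ ≤ B := fun n => hB ⟨n, rfl⟩
  refine ⟨max 1 (max A B), le_max_left _ _, fun n => (hA' n).trans (by simp), fun n => ?_⟩
  rcases lt_or_ge n 0 with h | h
  · rw [recPoch_neg q h]; simp
  · simp only [recPoch, h, if_true]
    exact (hB' _).trans (by simp)

theorem gauss_eq_mul_qPoch {q : ℂ} (hq : ‖q‖ < 1) {n : ℤ} (hn : 0 ≤ n) (k : ℤ) :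
    gauss q n k = recPoch q k * recPoch q (n - k) * qPoch q n.toNat := by
  rw [← gauss_mul_recPoch hq]
  simp only [recPoch, hn, if_true]
  rw [inv_mul_cancel_right₀ (qPoch_ne_zero hq _)]

theorem exists_norm_gauss_le {q : ℂ} (hq : ‖q‖ < 1) :
    ∃ C : ℝ, 0 ≤ C ∧ ∀ n k : ℤ, 0 ≤ n → ‖gauss q n k‖ ≤ C := by
  obtain ⟨C, hC1, hC, hC'⟩ := exists_norm_qPoch_le hq
  refine ⟨C * C * C, by positivity, fun n k hn => ?_⟩
  rw [gauss_eq_mul_qPoch hq hn, norm_mul, norm_mul]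
  gcongr
  exacts [hC' _, hC' _, hC _]

/-- `k (k - 1) / 2`. -/
def tri (k : ℤ) : ℤ := k * (k - 1) / 2

theorem two_mul_tri (k : ℤ) : 2 * tri k = k * (k - 1) :=
  Int.mul_ediv_cancel' (Int.even_mul_pred_self k).two_dvd

theorem tri_add_one (k : ℤ) : tri (k + 1) = tri k + k := by
  have h1 := two_mul_tri k
  have h2 := two_mul_tri (k + 1)
  linarith

theorem norm_prod_le_of_neg {q : ℂ} (hq0 : q ≠ 0) (hq : ‖q‖ < 1) {n : ℤ} (hn : n < 0) (k : ℕ) :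
    ‖∏ i ∈ Finset.range k, (1 - q ^ (n - i))‖ ≤
      (∏ i ∈ Finset.range k, (1 + ‖q‖ ^ (i + 1))) * ‖q‖ ^ (n * k - tri k) := by
  have hρ : 0 < ‖q‖ := norm_pos_iff.mpr hq0
  induction k with
  | zero => simp [tri]
  | succ k ih =>
    have h1 : ‖1 - q ^ (n - k)‖ ≤ (1 + ‖q‖ ^ (k + 1)) * ‖q‖ ^ (n - k) := by
      calc ‖1 - q ^ (n - k)‖ ≤ 1 + ‖q‖ ^ (n - k) := by
            simpa using norm_sub_le (1 : ℂ) (q ^ (n - k))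
        _ = (1 + ‖q‖ ^ (k - n)) * ‖q‖ ^ (n - k) := by
            rw [add_mul, one_mul, ← zpow_add₀ hρ.ne', add_comm]; simp
        _ ≤ _ := by
            gcongr
            rw [← zpow_natCast]
            exact zpow_le_zpow_right_of_le_one₀ hρ hq.le (by push_cast; omega)
    have h2 : n * ((k + 1 : ℕ) : ℤ) - tri ((k + 1 : ℕ) : ℤ) = (n * k - tri k) + (n - k) := by
      push_cast; rw [tri_add_one]; ring
    rw [Finset.prod_range_succ, Finset.prod_range_succ, norm_mul, h2, zpow_add₀ hρ.ne']
    calc _ ≤ _ := mul_le_mul ih h1 (norm_nonneg _) (by positivity)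
      _ = _ := by ring

/-- For negative `n` the Gaussian binomial is unbounded in `k`, but its growth `|q|^(-k²/2 + …)` is
only half as strong as the decay of `q^(k²)`. -/
theorem exists_norm_gauss_le_of_neg {q : ℂ} (hq0 : q ≠ 0) (hq : ‖q‖ < 1) :
    ∃ C : ℝ, 0 ≤ C ∧ ∀ n k : ℤ, n < 0 → ‖gauss q n k‖ ≤ C * ‖q‖ ^ (n * k - tri k) := by
  obtain ⟨C, hC1, -, hC'⟩ := exists_norm_qPoch_le hq
  have hρ : 0 < ‖q‖ := norm_pos_iff.mpr hq0
  have hs : Summable fun i : ℕ => ‖q‖ ^ (i + 1) :=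
    (summable_nat_add_iff 1).mpr (summable_geometric_of_lt_one (norm_nonneg _) hq)
  refine ⟨Real.exp (∑' i : ℕ, ‖q‖ ^ (i + 1)) * C, by positivity, fun n k hn => ?_⟩
  rcases lt_or_ge k 0 with h | h
  · rw [gauss_neg q n h, norm_zero]; positivity
  · obtain ⟨m, rfl⟩ := Int.eq_ofNat_of_zero_le h
    rw [gauss, norm_mul, Int.toNat_natCast, mul_right_comm]
    refine mul_le_mul ((norm_prod_le_of_neg hq0 hq hn m).trans ?_) (hC' _) (norm_nonneg _)
      (by positivity)
    gcongr
    refine (Finset.prod_le_prod (fun i _ => by positivity) fun i _ => ?_).trans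
      ((Real.exp_sum _ _).symm.le.trans (Real.exp_le_exp.mpr (hs.sum_le_tsum (Finset.range m)
        fun i _ => by positivity)))
    rw [add_comm]; exact Real.add_one_le_exp _

theorem exists_norm_gauss_le_add {q : ℂ} (hq0 : q ≠ 0) (hq : ‖q‖ < 1) :
    ∃ C : ℝ, 0 ≤ C ∧ ∀ n k : ℤ, ‖gauss q n k‖ ≤ C * (1 + ‖q‖ ^ (n * k - tri k)) := by
  obtain ⟨A, hA0, hA⟩ := exists_norm_gauss_le hq
  obtain ⟨B, hB0, hB⟩ := exists_norm_gauss_le_of_neg hq0 hq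
  refine ⟨A + B, by positivity, fun n k => ?_⟩
  have h1 : 0 ≤ ‖q‖ ^ (n * k - tri k) := by positivity
  rcases lt_or_ge n 0 with h | h
  · refine (hB n k h).trans ?_
    nlinarith
  · refine (hA n k h).trans ?_
    nlinarith

/-! ### Summability of powers with quadratic exponents. -/

theorem summable_zpow_of_abs_le {r : ℝ} (h0 : 0 < r) (h1 : r < 1) {e : ℤ → ℤ} (D : ℤ)
    (he : ∀ s, |s| - D ≤ e s) : Summable fun s : ℤ => r ^ e s := by
  have h2 : Summable fun s : ℤ => r ^ |s| := by
    rw [summable_int_iff_summable_nat_and_neg]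
    have := summable_geometric_of_lt_one h0.le h1
    exact ⟨by simpa using this, by simpa using this⟩
  refine (h2.mul_left (r ^ (-D))).of_nonneg_of_le (fun s => by positivity) fun s => ?_
  rw [← zpow_add₀ h0.ne']
  exact zpow_le_zpow_right_of_le_one₀ h0 h1.le (by linarith [he s])

theorem exists_abs_le_quadratic (b c : ℤ) : ∃ D : ℤ, ∀ s : ℤ, 2 * (|s| - D) ≤ s ^ 2 + b * s + c := by
  -- With `t = |s|`, the minimum of `t² - (|b| + 2) t` is `-(|b| + 2)² / 4`, so this value is
  -- generous.
  refine ⟨(|b| + 2) ^ 2 + |c|, fun s => ?_⟩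
  have h1 : -(|b| * |s|) ≤ b * s := by rw [← abs_mul]; exact neg_abs_le _
  have h2 := neg_abs_le c
  have h3 := sq_abs s
  nlinarith [abs_nonneg b, abs_nonneg s, abs_nonneg c, sq_nonneg (|s| - (|b| + 2)),
    mul_nonneg (abs_nonneg b) (abs_nonneg s)]

/-- The bound is on `2 e` because the critical exponents below are of the form `s²/2 + …`. -/
theorem summable_zpow_of_quadratic {r : ℝ} (h0 : 0 < r) (h1 : r < 1) {e : ℤ → ℤ} (b c : ℤ)
    (he : ∀ s, s ^ 2 + b * s + c ≤ 2 * e s) : Summable fun s : ℤ => r ^ e s := by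
  obtain ⟨D, hD⟩ := exists_abs_le_quadratic b c
  exact summable_zpow_of_abs_le h0 h1 D fun s => by linarith [he s, hD s]

theorem summable_zpow_sq {r : ℝ} (h0 : 0 < r) (h1 : r < 1) : Summable fun s : ℤ => r ^ s ^ 2 :=
  summable_zpow_of_abs_le h0 h1 0 fun s => by
    rcases abs_cases s with ⟨h, _⟩ | ⟨h, _⟩ <;> rw [h] <;> nlinarith

/-! ### Summation formulas -/

theorem summable_mul_gauss_mul {q : ℂ} (hq0 : q ≠ 0) (hq : ‖q‖ < 1) (n c a b : ℤ)
    {g : ℤ → ℂ} {B : ℝ} (hg : ∀ s, ‖g s‖ ≤ B) :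
    Summable fun s : ℤ => q ^ (s ^ 2 + a * s + b) * gauss q n (s + c) * g s := by
  have hρ : 0 < ‖q‖ := norm_pos_iff.mpr hq0
  obtain ⟨C, hC0, hC⟩ := exists_norm_gauss_le_add hq0 hq
  have hB : 0 ≤ B := (norm_nonneg _).trans (hg 0)
  have h1 : Summable fun s : ℤ => ‖q‖ ^ (s ^ 2 + a * s + b) :=
    summable_zpow_of_quadratic hρ hq (2 * a) (2 * b) fun s => by nlinarith [sq_nonneg s]
  have h2 : Summable fun s : ℤ =>
      ‖q‖ ^ (s ^ 2 + a * s + b + (n * (s + c) - tri (s + c))) :=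
    summable_zpow_of_quadratic hρ hq (2 * a + 2 * n - 2 * c + 1) (2 * b + 2 * n * c - c ^ 2 + c)
      fun s => by nlinarith [two_mul_tri (s + c)]
  refine ((h1.add h2).mul_left (C * B)).of_norm_bounded fun s => ?_
  rw [norm_mul, norm_mul, norm_zpow, zpow_add₀ hρ.ne' (s ^ 2 + a * s + b)]
  calc _ ≤ ‖q‖ ^ (s ^ 2 + a * s + b) * (C * (1 + ‖q‖ ^ (n * (s + c) - tri (s + c)))) * B := by
        gcongr
        exacts [hC _ _, hg _]
    _ = _ := by ring

/-- Pascal's rule splits the sum in two. In the second part `q^s / (q)_s = 1/(q)_s - 1/(q)_{s-1}`,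
and the contribution of `1/(q)_{s-1}`, after `s ↦ s + 1`, cancels the first part. -/
theorem tsum_gauss_shift {q : ℂ} (hq0 : q ≠ 0) (hq : ‖q‖ < 1) (n c : ℤ) :
    ∑' s : ℤ, q ^ (s * (s + c)) * gauss q n (s + c) * recPoch q s =
      ∑' s : ℤ, q ^ (s * (s + (c - 1))) * gauss q (n - 1) (s + (c - 1)) * recPoch q s := by
  obtain ⟨B, -, -, hB⟩ := exists_norm_qPoch_le hq
  have e0 : ∀ s : ℤ, s * (s + c) + (s + c) = s ^ 2 + (c + 1) * s + c := fun s => by ring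
  have e1 : ∀ s : ℤ, s * (s + (c - 1)) = s ^ 2 + (c - 1) * s + 0 := fun s => by ring
  have e2 : ∀ s : ℤ, s * (s + c) = s ^ 2 + c * s + 0 := fun s => by ring
  have S0 : Summable fun s : ℤ =>
      q ^ (s * (s + c) + (s + c)) * gauss q (n - 1) (s + c) * recPoch q s := by
    simp only [e0]; exact summable_mul_gauss_mul hq0 hq _ _ _ _ hB
  have S1 : Summable fun s : ℤ =>
      q ^ (s * (s + (c - 1))) * gauss q (n - 1) (s + (c - 1)) * recPoch q s := by
    simp only [e1]; exact summable_mul_gauss_mul hq0 hq _ _ _ _ hB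
  have S2 : Summable fun s : ℤ =>
      q ^ (s * (s + (c - 1))) * gauss q (n - 1) (s + (c - 1)) * recPoch q (s - 1) := by
    simp only [e1]
    exact summable_mul_gauss_mul hq0 hq _ _ _ _ (g := fun s => recPoch q (s - 1)) fun s => hB _
  have h : ∀ s : ℤ, q ^ (s * (s + c)) * gauss q n (s + c) * recPoch q s =
      q ^ (s * (s + c) + (s + c)) * gauss q (n - 1) (s + c) * recPoch q s +
      (q ^ (s * (s + (c - 1))) * gauss q (n - 1) (s + (c - 1)) * recPoch q s -
      q ^ (s * (s + (c - 1))) * gauss q (n - 1) (s + (c - 1)) * recPoch q (s - 1)) := fun s => by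
    have h3 : q ^ (s * (s + c)) = q ^ (s * (s + (c - 1))) * q ^ s := by
      rw [← zpow_add₀ hq0]; congr 1; ring
    rw [gauss_pascal hq0 hq n, ← recPoch_mul_one_sub hq s, zpow_add₀ hq0 (s * (s + c)), h3,
      add_sub_assoc]
    ring
  have h4 : ∑' s : ℤ, q ^ (s * (s + (c - 1))) * gauss q (n - 1) (s + (c - 1)) * recPoch q (s - 1) =
      ∑' s : ℤ, q ^ (s * (s + c) + (s + c)) * gauss q (n - 1) (s + c) * recPoch q s := by
    rw [← (Equiv.addRight (1 : ℤ)).tsum_eq]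
    refine tsum_congr fun s => ?_
    simp only [Equiv.coe_addRight]
    have e : s + 1 + (c - 1) = s + c := by ring
    rw [e, add_sub_cancel_right]
    congr 3
    ring
  rw [tsum_congr h, S0.tsum_add (S1.sub S2), S1.tsum_sub S2, h4]
  ring

/-- A terminating or convergent form of the `q`-Chu–Vandermonde sum, for all integers `n`, `c`. -/
theorem tsum_gauss_mul_recPoch {q : ℂ} (hq0 : q ≠ 0) (hq : ‖q‖ < 1) (n c : ℤ) :
    ∑' s : ℤ, q ^ (s * (s + c)) * gauss q n (s + c) * recPoch q s = recPoch q (n - c) := by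
  -- The sum depends on `n - c` only, so the upper entry can be moved to `0`, where the single term
  -- `s = n - c` survives.
  have key : ∀ m c : ℤ, ∑' s : ℤ, q ^ (s * (s + (c + m))) * gauss q m (s + (c + m)) * recPoch q s =
      ∑' s : ℤ, q ^ (s * (s + c)) * gauss q 0 (s + c) * recPoch q s := by
    intro m c
    induction m with
    | zero => simp
    | succ m ih =>
      rw [tsum_gauss_shift hq0 hq, ← ih]
      simp only [add_sub_cancel_right, add_sub_assoc]
    | pred m ih =>
      rw [← ih, tsum_gauss_shift hq0 hq (-(m : ℤ))]
      simp only [add_sub_assoc]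
  have h := key n (c - n)
  simp only [sub_add_cancel] at h
  rw [h, tsum_eq_single (n - c)]
  · simp
  · intro s hs
    rw [gauss_zero_left hq (by omega)]; simp

theorem gauss_mul_gauss_eq_zero (q : ℂ) (m n K t : ℤ) (h : t ∉ Finset.Icc 0 K) :
    gauss q m t * gauss q n (K - t) = 0 := by
  rw [Finset.mem_Icc, not_and_or] at h
  rcases h with h | h
  · rw [gauss_neg q m (by omega), zero_mul]
  · rw [gauss_neg q n (by omega), mul_zero]

/-- Induction on `m` by Pascal's rule on both sides; the sums are finite. A negative `n` must be
allowed, since the kernel identity uses it with `n = y + l` for `l` of either sign. -/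
theorem gauss_vandermonde {q : ℂ} (hq0 : q ≠ 0) (hq : ‖q‖ < 1) (m : ℕ) (n K : ℤ) :
    gauss q (m + n) K =
      ∑' t : ℤ, gauss q m t * gauss q n (K - t) * q ^ ((m - t) * (K - t)) := by
  have hsum : ∀ (m n K : ℤ) (f : ℤ → ℂ),
      Summable fun t : ℤ => gauss q m t * gauss q n (K - t) * f t := fun m n K f =>
    summable_of_ne_finset_zero (s := Finset.Icc 0 K) fun t ht => by
      rw [gauss_mul_gauss_eq_zero q m n K t ht, zero_mul]
  induction m generalizing K with
  | zero =>
    rw [tsum_eq_single 0]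
    · simp
    · intro t ht; simp [gauss_zero_left hq ht]
  | succ m ih =>
    have h1 : ∀ t : ℤ, gauss q ((m + 1 : ℕ) : ℤ) t * gauss q n (K - t) *
          q ^ ((((m + 1 : ℕ) : ℤ) - t) * (K - t)) =
        q ^ K * (gauss q m t * gauss q n (K - t) * q ^ ((m - t) * (K - t))) +
        gauss q m (t - 1) * gauss q n (K - 1 - (t - 1)) *
          q ^ ((m - (t - 1)) * (K - 1 - (t - 1))) := fun t => by
      have e1 : q ^ t * q ^ ((((m + 1 : ℕ) : ℤ) - t) * (K - t)) =
          q ^ K * q ^ (((m : ℤ) - t) * (K - t)) := by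
        rw [← zpow_add₀ hq0, ← zpow_add₀ hq0]; congr 1; push_cast; ring
      have e2 : (((m + 1 : ℕ) : ℤ) - t) * (K - t) = (m - (t - 1)) * (K - 1 - (t - 1)) := by
        push_cast; ring
      have e3 : ((m + 1 : ℕ) : ℤ) - 1 = m := by push_cast; ring
      have e4 : K - 1 - (t - 1) = K - t := by ring
      rw [gauss_pascal hq0 hq, add_mul, add_mul, e3, ← e2, e4]
      linear_combination (gauss q m t * gauss q n (K - t)) * e1
    have h2 : gauss q (((m + 1 : ℕ) : ℤ) + n) K =
        q ^ K * gauss q (m + n) K + gauss q (m + n) (K - 1) := by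
      rw [gauss_pascal hq0 hq]; push_cast; congr 3 <;> ring
    have h3 := (Equiv.subRight (1 : ℤ)).tsum_eq fun t : ℤ =>
      gauss q m t * gauss q n (K - 1 - t) * q ^ ((m - t) * (K - 1 - t))
    have h4 := (Equiv.subRight (1 : ℤ)).summable_iff.mpr
      (hsum m n (K - 1) fun t => q ^ ((m - t) * (K - 1 - t)))
    simp only [Equiv.subRight_apply] at h3
    simp only [Function.comp_def, Equiv.subRight_apply] at h4
    rw [tsum_congr h1, ((hsum m n K _).mul_left _).tsum_add h4, tsum_mul_left, h3, ← ih, ← ih, h2]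

/-- The Gaussian binomial, set to `0` for a negative upper entry. -/
def gaussNat (q : ℂ) (n k : ℤ) : ℂ := if 0 ≤ n then gauss q n k else 0

theorem gaussNat_eq_zero {q : ℂ} (hq : ‖q‖ < 1) {n k : ℤ} (h : ¬ (0 ≤ k ∧ k ≤ n)) :
    gaussNat q n k = 0 := by
  unfold gaussNat
  split_ifs with hn
  · rcases lt_or_ge k 0 with hk | hk
    · exact gauss_neg q n hk
    · exact gauss_of_lt hq hn (by omega)
  · rfl

theorem exists_norm_gaussNat_le {q : ℂ} (hq : ‖q‖ < 1) :
    ∃ C : ℝ, 0 ≤ C ∧ ∀ n k : ℤ, ‖gaussNat q n k‖ ≤ C := by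
  obtain ⟨C, hC0, hC⟩ := exists_norm_gauss_le hq
  refine ⟨C, hC0, fun n k => ?_⟩
  unfold gaussNat
  split_ifs with h
  · exact hC n k h
  · simpa

theorem gauss_mul_recPoch_eq_zero (q : ℂ) {n z l : ℤ} (h : z < |l|) :
    gauss q n (z + l) * recPoch q (z - l) = 0 := by
  rcases abs_cases l with ⟨h1, _⟩ | ⟨h1, _⟩
  · rw [recPoch_neg q (by omega : z - l < 0), mul_zero]
  · rw [gauss_neg q n (by omega : z + l < 0), zero_mul]

/-- Writing `y + z = (z - l) + (y + l)`, `q`-Vandermonde expands `[y + z, 2x]` over `t`. Since `[z -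
l, t] / (q)_{z-l} = 1 / ((q)_t (q)_{z-l-t})`, the sum over `z` is then of `q`-Chu–Vandermonde type,
and `t = x - p` gives the right-hand side. -/
theorem tsum_bailey_kernel {q : ℂ} (hq0 : q ≠ 0) (hq : ‖q‖ < 1) {y : ℤ} (hy : 0 ≤ y) (x n l : ℤ) :
    ∑' z : ℤ, q ^ (z - x) ^ 2 * gaussNat q (y + z) (2 * x) *
        (gauss q (x + n) (z + l) * recPoch q (z - l)) =
      ∑' p : ℤ, q ^ (l - p) ^ 2 * recPoch q (n - 2 * l + p) *
        (gauss q (y + l) (x + p) * recPoch q (x - p)) := by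
  obtain ⟨B, -, -, hB⟩ := exists_norm_qPoch_le hq
  have h1 : ∀ z : ℤ, q ^ (z - x) ^ 2 * gaussNat q (y + z) (2 * x) *
        (gauss q (x + n) (z + l) * recPoch q (z - l)) =
      ∑ t ∈ Finset.Icc 0 (2 * x), recPoch q t * gauss q (y + l) (2 * x - t) *
        (q ^ ((z - x) ^ 2 + (z - l - t) * (2 * x - t)) * gauss q (x + n) (z + l) *
          recPoch q (z - l - t)) := by
    intro z
    -- Below `|l|` both sides vanish. From `|l|` on, `z - l` is a natural number, as Vandermonde
    -- requires, and `y + z ≥ 0`, so the truncation in `gaussNat` is not felt.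
    rcases lt_or_ge z |l| with hz | hz
    · rw [gauss_mul_recPoch_eq_zero q hz, mul_zero]
      refine (Finset.sum_eq_zero fun t ht => ?_).symm
      have ht0 := (Finset.mem_Icc.mp ht).1
      rcases abs_cases l with ⟨h1, _⟩ | ⟨h1, _⟩
      · rw [recPoch_neg q (by omega : z - l - t < 0)]; simp
      · rw [gauss_neg q _ (by omega : z + l < 0)]; simp
    · have hl := le_abs_self l
      have hz0 := abs_nonneg l
      obtain ⟨m, hm⟩ := Int.eq_ofNat_of_zero_le (by omega : 0 ≤ z - l)
      have e1 : y + z = (m : ℤ) + (y + l) := by omega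
      rw [gaussNat, if_pos (by omega), e1, gauss_vandermonde hq0 hq, ← hm,
        tsum_eq_sum (s := Finset.Icc 0 (2 * x)) fun t ht => by
          rw [gauss_mul_gauss_eq_zero q _ _ _ t ht, zero_mul],
        Finset.mul_sum, Finset.sum_mul]
      refine Finset.sum_congr rfl fun t _ => ?_
      rw [zpow_add₀ hq0]
      linear_combination (q ^ (z - x) ^ 2 * gauss q (y + l) (2 * x - t) *
        q ^ ((z - l - t) * (2 * x - t)) * gauss q (x + n) (z + l)) *
        gauss_mul_recPoch hq (z - l) t
  have h2 : ∀ t : ℤ, Summable fun z : ℤ =>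
      recPoch q t * gauss q (y + l) (2 * x - t) *
        (q ^ ((z - x) ^ 2 + (z - l - t) * (2 * x - t)) * gauss q (x + n) (z + l) *
          recPoch q (z - l - t)) := fun t => by
    have e : ∀ z : ℤ, (z - x) ^ 2 + (z - l - t) * (2 * x - t) =
        z ^ 2 + (-t) * z + (x ^ 2 - (l + t) * (2 * x - t)) := fun z => by ring
    simp only [e]
    exact (summable_mul_gauss_mul hq0 hq _ _ _ _ (g := fun z => recPoch q (z - l - t))
      fun s => hB _).mul_left _
  have h3 : ∀ t : ℤ, ∑' z : ℤ, recPoch q t * gauss q (y + l) (2 * x - t) *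
        (q ^ ((z - x) ^ 2 + (z - l - t) * (2 * x - t)) * gauss q (x + n) (z + l) *
          recPoch q (z - l - t)) =
      recPoch q t * gauss q (y + l) (2 * x - t) *
        (q ^ (l + t - x) ^ 2 * recPoch q (x + n - (2 * l + t))) := fun t => by
    rw [tsum_mul_left, ← tsum_gauss_mul_recPoch hq0 hq, ← tsum_mul_left (a := q ^ (l + t - x) ^ 2),
      ← (Equiv.addRight (l + t)).tsum_eq]
    congr 1
    refine tsum_congr fun s => ?_
    simp only [Equiv.coe_addRight]
    have e : (s + (l + t) - x) ^ 2 + (s + (l + t) - l - t) * (2 * x - t) =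
      (l + t - x) ^ 2 + s * (s + (2 * l + t)) := by ring
    have e2 : s + (l + t) + l = s + (2 * l + t) := by ring
    have e3 : s + (l + t) - l - t = s := by ring
    rw [e, e2, e3, zpow_add₀ hq0]
    ring
  rw [tsum_congr h1, Summable.tsum_finsetSum fun t _ => h2 t, Finset.sum_congr rfl fun t _ => h3 t,
    ← (Equiv.subLeft x).tsum_eq, tsum_eq_sum (s := Finset.Icc 0 (2 * x))]
  · refine Finset.sum_congr rfl fun t _ => ?_
    simp only [Equiv.subLeft_apply]
    have e1 : (l - (x - t)) ^ 2 = (l + t - x) ^ 2 := by ring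
    have e2 : n - 2 * l + (x - t) = x + n - (2 * l + t) := by ring
    have e3 : x + (x - t) = 2 * x - t := by ring
    have e4 : x - (x - t) = t := by ring
    rw [e1, e2, e3, e4]
    ring
  · intro t ht
    simp only [Equiv.subLeft_apply]
    rw [Finset.mem_Icc, not_and_or] at ht
    rcases ht with h | h
    · rw [recPoch_neg q (by omega : x - (x - t) < 0)]; simp
    · rw [gauss_neg q _ (by omega : x + (x - t) < 0)]; simp

/-! ### Nearest-neighbour weights on integer paths -/

/-- Total weight of the integer paths `0 = K_0, …, K_d, K_{d+1}` with `K_d = x` and `K_{d+1} = z`,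
each step weighted by `q ^ (K_{i+1} - K_i)²` and each interior vertex by `κ`. -/
def stepWeight (q : ℂ) (κ : ℤ → ℤ → ℤ → ℂ) : ℕ → ℤ → ℤ → ℂ
  | 0, x, z => if x = 0 then q ^ z ^ 2 else 0
  | d + 1, x, z => q ^ (z - x) ^ 2 * ∑' y, κ y x z * stepWeight q κ d y x

/-- The path `0, K_1, …, K_d, z, z, …`. -/
def pathExt {d : ℕ} (K : Fin d → ℤ) (z : ℤ) (i : ℕ) : ℤ :=
  if i = 0 then 0 else if h : i - 1 < d then K ⟨i - 1, h⟩ else z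

/-- The weight of a single path `0, K_1, …, K_d, z`. -/
def pathWeight (q : ℂ) (κ : ℤ → ℤ → ℤ → ℂ) {d : ℕ} (K : Fin d → ℤ) (z : ℤ) : ℂ :=
  q ^ (∑ i ∈ Finset.range (d + 1), (pathExt K z (i + 1) - pathExt K z i) ^ 2) *
    ∏ i ∈ Finset.range d, κ (pathExt K z i) (pathExt K z (i + 1)) (pathExt K z (i + 2))

@[simp] theorem pathExt_zero {d : ℕ} (K : Fin d → ℤ) (z : ℤ) : pathExt K z 0 = 0 := by
  simp [pathExt]

theorem pathExt_succ {d : ℕ} (K : Fin d → ℤ) (z : ℤ) {i : ℕ} (h : i < d) :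
    pathExt K z (i + 1) = K ⟨i, h⟩ := by simp [pathExt, h]

@[simp] theorem pathExt_last {d : ℕ} (K : Fin d → ℤ) (z : ℤ) : pathExt K z (d + 1) = z := by
  simp [pathExt]

theorem pathExt_snoc {d : ℕ} (K : Fin d → ℤ) (x z : ℤ) {i : ℕ} (h : i ≤ d + 1) :
    pathExt (Fin.snoc K x : Fin (d + 1) → ℤ) z i = pathExt K x i := by
  rcases i with _ | i
  · simp
  · rw [pathExt_succ _ _ (by omega : i < d + 1)]
    rcases Nat.lt_or_ge i d with h1 | h1
    · rw [pathExt_succ _ _ h1]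
      exact Fin.snoc_castSucc (α := fun _ => ℤ) x K ⟨i, h1⟩
    · obtain rfl : i = d := by omega
      rw [pathExt_last]
      exact Fin.snoc_last (α := fun _ => ℤ) x K

theorem pathWeight_snoc {q : ℂ} (hq0 : q ≠ 0) (κ : ℤ → ℤ → ℤ → ℂ) {d : ℕ} (K : Fin d → ℤ)
    (x z : ℤ) : pathWeight q κ (Fin.snoc K x : Fin (d + 1) → ℤ) z =
      pathWeight q κ K x * (q ^ (z - x) ^ 2 * κ (pathExt K x d) x z) := by
  have h1 : pathExt (Fin.snoc K x : Fin (d + 1) → ℤ) z (d + 2) = z := pathExt_last _ _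
  have h2 : pathExt (Fin.snoc K x : Fin (d + 1) → ℤ) z (d + 1) = x := by
    rw [pathExt_snoc K x z le_rfl, pathExt_last]
  rw [pathWeight, Finset.sum_range_succ, Finset.prod_range_succ, zpow_add₀ hq0, h1, h2,
    pathExt_snoc K x z (by omega : d ≤ d + 1), pathWeight]
  have h3 : ∑ i ∈ Finset.range (d + 1), (pathExt (Fin.snoc K x : Fin (d + 1) → ℤ) z (i + 1) -
      pathExt (Fin.snoc K x : Fin (d + 1) → ℤ) z i) ^ 2 =
      ∑ i ∈ Finset.range (d + 1), (pathExt K x (i + 1) - pathExt K x i) ^ 2 :=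
    Finset.sum_congr rfl fun i hi => by
      have := Finset.mem_range.mp hi
      rw [pathExt_snoc K x z (by omega), pathExt_snoc K x z (by omega)]
  have h4 : ∏ i ∈ Finset.range d, κ (pathExt (Fin.snoc K x : Fin (d + 1) → ℤ) z i)
      (pathExt (Fin.snoc K x : Fin (d + 1) → ℤ) z (i + 1))
      (pathExt (Fin.snoc K x : Fin (d + 1) → ℤ) z (i + 2)) =
      ∏ i ∈ Finset.range d, κ (pathExt K x i) (pathExt K x (i + 1)) (pathExt K x (i + 2)) :=
    Finset.prod_congr rfl fun i hi => by
      have := Finset.mem_range.mp hi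
      rw [pathExt_snoc K x z (by omega), pathExt_snoc K x z (by omega),
        pathExt_snoc K x z (by omega)]
  rw [h3, h4]
  ring

/-! ### Convergence and factorization of path sums. -/

theorem summable_mul_comp_sub {α : Type*} {f : α → ℝ} (hf : Summable f) (hf0 : ∀ a, 0 ≤ f a)
    {h : ℤ → ℝ} (hh : Summable h) (hh0 : ∀ s, 0 ≤ h s) (g : α → ℤ) :
    Summable fun p : α × ℤ => f p.1 * h (p.2 - g p.1) := by
  refine (hf.mul_of_nonneg hh hf0 hh0).comp_injective
    (i := fun p : α × ℤ => (p.1, p.2 - g p.1)) ?_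
  rintro ⟨a, b⟩ ⟨a', b'⟩ h
  simp only [Prod.mk.injEq] at h
  obtain ⟨rfl, h⟩ := h
  simpa using h

theorem summable_mul_zpow_sub_sq {q : ℂ} (hq0 : q ≠ 0) (hq : ‖q‖ < 1) {α : Type*} {f : α → ℝ}
    (hf : Summable f) (hf0 : ∀ a, 0 ≤ f a) (g : α → ℤ) :
    Summable fun p : α × ℤ => f p.1 * ‖q‖ ^ (p.2 - g p.1) ^ 2 :=
  summable_mul_comp_sub hf hf0 (summable_zpow_sq (norm_pos_iff.mpr hq0) hq)
    (fun _ => by positivity) g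

/-- Each new step contributes a factor summable over its endpoint, and bounded vertex weights cost
only a constant. The pointwise bound serves `summable_bailey_right`, where the weight must absorb an
unbounded Gaussian binomial. -/
theorem summable_norm_stepWeight {q : ℂ} (hq0 : q ≠ 0) (hq : ‖q‖ < 1)
    {κ : ℤ → ℤ → ℤ → ℂ} {C : ℝ}
    (hκ : ∀ y x z, ‖κ y x z‖ ≤ C) (d : ℕ) :
    (Summable fun p : ℤ × ℤ => ‖stepWeight q κ d p.1 p.2‖) ∧
      ∃ D : ℝ, 0 ≤ D ∧ ∀ x z, ‖stepWeight q κ d x z‖ ≤ D * ‖q‖ ^ (z - x) ^ 2 := by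
  have hC : 0 ≤ C := (norm_nonneg _).trans (hκ 0 0 0)
  induction d with
  | zero =>
    constructor
    · have h1 : Summable fun x : ℤ => if x = 0 then (1 : ℝ) else 0 :=
        summable_of_ne_finset_zero (s := {0}) fun x hx => by simp_all
      refine (summable_mul_zpow_sub_sq hq0 hq h1 (fun a => by split_ifs <;> simp)
        fun x => x).congr fun p => ?_
      simp only [stepWeight]
      split_ifs with h <;> simp [h]
    · refine ⟨1, zero_le_one, fun x z => ?_⟩
      simp only [stepWeight]
      split_ifs with h
      · simp [h]
      · simp; positivity
  | succ d ih =>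
    obtain ⟨hs, -⟩ := ih
    have hs' := hs.prod_symm
    have h1 : ∀ x, Summable fun y => ‖stepWeight q κ d y x‖ := fun x => hs'.prod_factor x
    have h2 : Summable fun x => ∑' y, ‖stepWeight q κ d y x‖ := hs'.prod
    have h20 : ∀ x, 0 ≤ ∑' y, ‖stepWeight q κ d y x‖ := fun x => tsum_nonneg fun _ => norm_nonneg _
    have h3 : ∀ x z, ‖stepWeight q κ (d + 1) x z‖ ≤
        C * (∑' y, ‖stepWeight q κ d y x‖) * ‖q‖ ^ (z - x) ^ 2 := fun x z => by
      simp only [stepWeight]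
      rw [norm_mul, norm_zpow, mul_comm, ← tsum_mul_left]
      gcongr
      refine tsum_of_norm_bounded ((h1 x).mul_left C).hasSum fun y => ?_
      rw [norm_mul]
      gcongr
      exact hκ _ _ _
    constructor
    · exact (summable_mul_zpow_sub_sq hq0 hq (h2.mul_left C) (fun x => mul_nonneg hC (h20 x))
        fun x => x).of_nonneg_of_le (fun _ => norm_nonneg _) fun p => h3 p.1 p.2
    · refine ⟨C * ∑' x, ∑' y, ‖stepWeight q κ d y x‖,
        mul_nonneg hC (tsum_nonneg h20), fun x z => (h3 x z).trans ?_⟩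
      exact mul_le_mul_of_nonneg_right (mul_le_mul_of_nonneg_left
        (h2.le_tsum x fun _ _ => h20 _) hC) (by positivity)

theorem summable_norm_pathWeight {q : ℂ} (hq0 : q ≠ 0) (hq : ‖q‖ < 1)
    {κ : ℤ → ℤ → ℤ → ℂ} {C : ℝ}
    (hκ : ∀ y x z, ‖κ y x z‖ ≤ C) (d : ℕ) :
    Summable fun p : (Fin d → ℤ) × ℤ => ‖pathWeight q κ p.1 p.2‖ := by
  have hC : 0 ≤ C := (norm_nonneg _).trans (hκ 0 0 0)
  induction d with
  | zero =>
    refine (Equiv.uniqueProd ℤ (Fin 0 → ℤ)).symm.summable_iff.mp ?_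
    simpa [Function.comp_def, pathWeight, pathExt] using
      summable_zpow_sq (norm_pos_iff.mpr hq0) hq
  | succ d ih =>
    have h1 := summable_mul_zpow_sub_sq hq0 hq (ih.mul_left C) (fun _ => by positivity) Prod.snd
    let e : ((Fin d → ℤ) × ℤ) × ℤ ≃ (Fin (d + 1) → ℤ) × ℤ :=
      ((Equiv.prodComm _ _).trans (Fin.snocEquiv fun _ => ℤ)).prodCongr (Equiv.refl ℤ)
    refine e.summable_iff.mp (h1.of_nonneg_of_le (fun _ => norm_nonneg _) ?_)
    rintro ⟨⟨K, x⟩, z⟩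
    change ‖pathWeight q κ (Fin.snoc K x : Fin (d + 1) → ℤ) z‖ ≤ _
    rw [pathWeight_snoc hq0, norm_mul, norm_mul, norm_zpow]
    have := hκ (pathExt K x d) x z
    calc _ ≤ ‖pathWeight q κ K x‖ * (‖q‖ ^ (z - x) ^ 2 * C) := by gcongr
      _ = _ := by ring

/-- The test function `φ` of the last vertex before `x` makes the induction close: the weight of a
vertex involves both neighbours, so removing the last step leaves a function of the preceding
vertex. -/
theorem tsum_pathWeight_mul {q : ℂ} (hq0 : q ≠ 0) (hq : ‖q‖ < 1)
    {κ : ℤ → ℤ → ℤ → ℂ} {C : ℝ}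
    (hκ : ∀ y x z, ‖κ y x z‖ ≤ C) (d : ℕ) (x : ℤ) {φ : ℤ → ℂ} {B : ℝ} (hφ : ∀ y, ‖φ y‖ ≤ B) :
    ∑' K : Fin d → ℤ, pathWeight q κ K x * φ (pathExt K x d) =
      ∑' y, stepWeight q κ d y x * φ y := by
  induction d generalizing x φ B with
  | zero =>
    rw [tsum_eq_single (0 : ℤ) fun y hy => by simp [stepWeight, hy],
      tsum_eq_single (default : Fin 0 → ℤ) fun K hK => (hK (Subsingleton.elim _ _)).elim]
    simp [pathWeight, stepWeight, pathExt]
  | succ d ih =>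
    let e : ℤ × (Fin d → ℤ) ≃ (Fin (d + 1) → ℤ) := Fin.snocEquiv fun _ => ℤ
    have hs : Summable fun K : Fin (d + 1) → ℤ => pathWeight q κ K x * φ (pathExt K x (d + 1)) := by
      have h1 := (summable_norm_pathWeight hq0 hq hκ (d + 1)).prod_symm.prod_factor x
      refine (h1.mul_right B).of_norm_bounded fun K => ?_
      rw [norm_mul]
      exact mul_le_mul_of_nonneg_left (hφ _) (norm_nonneg _)
    have h2 : ∀ p : ℤ × (Fin d → ℤ), pathWeight q κ (e p) x * φ (pathExt (e p) x (d + 1)) =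
        q ^ (x - p.1) ^ 2 * φ p.1 * (pathWeight q κ p.2 p.1 * κ (pathExt p.2 p.1 d) p.1 x) := by
      rintro ⟨y, K⟩
      change pathWeight q κ (Fin.snoc K y : Fin (d + 1) → ℤ) x *
        φ (pathExt (Fin.snoc K y : Fin (d + 1) → ℤ) x (d + 1)) = _
      rw [pathWeight_snoc hq0, pathExt_snoc K y x le_rfl, pathExt_last]
      ring
    have h3 := e.summable_iff.mpr hs
    simp only [Function.comp_def, h2] at h3
    rw [← e.tsum_eq, tsum_congr h2, h3.tsum_prod]
    refine tsum_congr fun y => ?_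
    change ∑' K : Fin d → ℤ, q ^ (x - y) ^ 2 * φ y *
      (pathWeight q κ K y * κ (pathExt K y d) y x) = _
    rw [tsum_mul_left, ih y (φ := fun y' => κ y' y x) (fun y' => hκ y' y x), stepWeight,
      mul_right_comm]
    simp only [mul_comm (κ _ _ _)]

theorem tsum_pathWeight {q : ℂ} (hq0 : q ≠ 0) (hq : ‖q‖ < 1)
    {κ : ℤ → ℤ → ℤ → ℂ} {C : ℝ}
    (hκ : ∀ y x z, ‖κ y x z‖ ≤ C) (d : ℕ) (x : ℤ) :
    ∑' K : Fin d → ℤ, pathWeight q κ K x = ∑' y, stepWeight q κ d y x := by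
  simpa using tsum_pathWeight_mul hq0 hq hκ d x (φ := fun _ => 1) (B := 1) (by simp)

/-! ### The higher-level conjugate Bailey pair -/

/-- The vertex weight on the side of the `(m, n)`-system. -/
def binKer (q : ℂ) (y x z : ℤ) : ℂ := gaussNat q (y + z) (2 * x)

/-- The vertex weight on the side of the vectors `η`. -/
def etaKer (q : ℂ) (y x z : ℤ) : ℂ := recPoch q (y + z - 2 * x)

theorem stepWeight_binKer_neg {q : ℂ} (hq : ‖q‖ < 1) (d : ℕ) {y : ℤ} (hy : y < 0) (x : ℤ) :
    stepWeight q (binKer q) d y x = 0 := by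
  cases d with
  | zero => simp [stepWeight, hy.ne]
  | succ d =>
    have h : ∀ a, gaussNat q a (2 * y) = 0 := fun a => gaussNat_eq_zero hq (by omega)
    simp [stepWeight, binKer, h]

/-- A finite form of the `γ`-sequence, tending to it as `n → ∞`. -/
def boundedGamma (q : ℂ) (d : ℕ) (l n : ℤ) : ℂ :=
  ∑' p : ℤ × ℤ, stepWeight q (binKer q) d p.1 p.2 *
    (gauss q (p.1 + n) (p.2 + l) * recPoch q (p.2 - l))

/-- Where `x + n ≥ 0` every factor but the Gaussian step is bounded. The other nonzero terms have `0
≤ x < -n`, finitely many `x`, and `q^((z-x)²)` beats the growth of the Gaussian binomial; `H`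
collects them. -/
theorem summable_bailey_left {q : ℂ} (hq0 : q ≠ 0) (hq : ‖q‖ < 1) (d : ℕ) (l n : ℤ) :
    Summable fun s : (ℤ × ℤ) × ℤ => stepWeight q (binKer q) d s.1.1 s.1.2 *
      (q ^ (s.2 - s.1.2) ^ 2 * gaussNat q (s.1.1 + s.2) (2 * s.1.2) *
        (gauss q (s.1.2 + n) (s.2 + l) * recPoch q (s.2 - l))) := by
  have hρ : 0 < ‖q‖ := norm_pos_iff.mpr hq0
  obtain ⟨G, hG0, hG⟩ := exists_norm_gaussNat_le hq
  obtain ⟨B, hB1, -, hB⟩ := exists_norm_qPoch_le hq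
  obtain ⟨C, hC0, hC⟩ := exists_norm_gauss_le hq
  obtain ⟨C', hC0', hC'⟩ := exists_norm_gauss_le_of_neg hq0 hq
  have hB0 : 0 ≤ B := zero_le_one.trans hB1
  obtain ⟨hw, -⟩ := summable_norm_stepWeight hq0 hq (κ := binKer q) (fun y x z => hG _ _) d
  let H : ℤ → ℝ := fun z => ∑ x ∈ Finset.Ico 0 (-n),
    ‖q‖ ^ ((z - x) ^ 2 + ((x + n) * (z + l) - tri (z + l)))
  have hH : Summable H := summable_sum fun x _ => by
    refine summable_zpow_of_quadratic hρ hq (-4 * x + 2 * (x + n) - 2 * l + 1)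
      (2 * x ^ 2 + 2 * (x + n) * l - l ^ 2 + l) fun z => ?_
    nlinarith [two_mul_tri (z + l)]
  have hH0 : ∀ z, 0 ≤ H z := fun z => Finset.sum_nonneg fun _ _ => by positivity
  have h1 := summable_mul_zpow_sub_sq hq0 hq (hw.mul_left (G * B * C))
    (fun _ => by positivity) Prod.snd
  have h2 := (hw.mul_left (G * B * C')).mul_of_nonneg hH (fun _ => by positivity) hH0
  refine (h1.add h2).of_norm_bounded ?_
  rintro ⟨⟨y, x⟩, z⟩
  simp only [norm_mul, norm_zpow]
  have hwn := norm_nonneg (stepWeight q (binKer q) d y x)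
  have hpos : 0 ≤ G * B * C * ‖stepWeight q (binKer q) d y x‖ * ‖q‖ ^ (z - x) ^ 2 := by positivity
  have hpos' : 0 ≤ G * B * C' * ‖stepWeight q (binKer q) d y x‖ * H z :=
    mul_nonneg (by positivity) (hH0 z)
  rcases lt_or_ge x 0 with hx | hx
  · rw [gaussNat_eq_zero hq (by omega)]
    simp only [norm_zero, mul_zero, zero_mul]
    linarith
  rcases lt_or_ge (x + n) 0 with hn | hn
  · refine le_trans ?_ (le_add_of_nonneg_left hpos)
    have h3 : ‖q‖ ^ ((z - x) ^ 2 + ((x + n) * (z + l) - tri (z + l))) ≤ H z :=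
      Finset.single_le_sum (f := fun x : ℤ =>
        ‖q‖ ^ ((z - x) ^ 2 + ((x + n) * (z + l) - tri (z + l))))
        (fun _ _ => by positivity) (Finset.mem_Ico.mpr ⟨hx, by omega⟩)
    rw [zpow_add₀ hρ.ne'] at h3
    calc _ ≤ ‖stepWeight q (binKer q) d y x‖ * (‖q‖ ^ (z - x) ^ 2 * G *
          (C' * ‖q‖ ^ ((x + n) * (z + l) - tri (z + l)) * B)) := by
          gcongr
          exacts [hG _ _, hC' _ _ hn, hB _]
      _ = G * B * C' * ‖stepWeight q (binKer q) d y x‖ *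
          (‖q‖ ^ (z - x) ^ 2 * ‖q‖ ^ ((x + n) * (z + l) - tri (z + l))) := by ring
      _ ≤ _ := mul_le_mul_of_nonneg_left h3 (by positivity)
  · refine le_trans ?_ (le_add_of_nonneg_right hpos')
    calc _ ≤ ‖stepWeight q (binKer q) d y x‖ * (‖q‖ ^ (z - x) ^ 2 * G * (C * B)) := by
          gcongr
          exacts [hG _ _, hC _ _ hn, hB _]
      _ = _ := by ring

/-- Here the Gaussian binomial is unbounded only for the finitely many `0 ≤ y < -l`, but it grows in
`x + p`, so the decay of the step ending at `x` is needed as well. -/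
theorem summable_bailey_right {q : ℂ} (hq0 : q ≠ 0) (hq : ‖q‖ < 1) (d : ℕ) (l n : ℤ) :
    Summable fun s : (ℤ × ℤ) × ℤ => stepWeight q (binKer q) d s.1.1 s.1.2 *
      (q ^ (l - s.2) ^ 2 * recPoch q (n - 2 * l + s.2) *
        (gauss q (s.1.1 + l) (s.1.2 + s.2) * recPoch q (s.1.2 - s.2))) := by
  have hρ : 0 < ‖q‖ := norm_pos_iff.mpr hq0
  obtain ⟨G, hG0, hG⟩ := exists_norm_gaussNat_le hq
  obtain ⟨B, hB1, -, hB⟩ := exists_norm_qPoch_le hq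
  obtain ⟨C, hC0, hC⟩ := exists_norm_gauss_le hq
  obtain ⟨C', hC0', hC'⟩ := exists_norm_gauss_le_of_neg hq0 hq
  have hB0 : 0 ≤ B := zero_le_one.trans hB1
  obtain ⟨hw, D, hD0, hD⟩ :=
    summable_norm_stepWeight hq0 hq (κ := binKer q) (fun y x z => hG _ _) d
  let H : ℤ → ℝ := fun s => ∑ y ∈ Finset.Ico 0 (-l),
    ‖q‖ ^ (tri (-s) + (l - y) * (-s) + (l ^ 2 + y ^ 2))
  have hH : Summable H := summable_sum fun y _ => by
    refine summable_zpow_of_quadratic hρ hq (-2 * (l - y) + 1) (2 * (l ^ 2 + y ^ 2)) fun s => ?_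
    nlinarith [two_mul_tri (-s)]
  have hH0 : ∀ z, 0 ≤ H z := fun z => Finset.sum_nonneg fun _ _ => by positivity
  have h1 := summable_mul_zpow_sub_sq hq0 hq (hw.mul_left (B * C * B)) (fun _ => by positivity)
    fun _ => l
  let F : ℤ → ℝ := Set.indicator (Set.Ico 0 (-l)) fun _ => D * B * C' * B
  have h4 : Summable F := summable_of_hasFiniteSupport ((Set.finite_Ico 0 (-l)).subset
    Set.support_indicator_subset)
  have h5 : Summable fun x : ℤ => ‖q‖ ^ |x| :=
    summable_zpow_of_abs_le hρ hq 0 fun s => by simp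
  have h40 : ∀ y : ℤ, 0 ≤ F y := Set.indicator_nonneg fun _ _ => by positivity
  have h2 := summable_mul_comp_sub (h4.mul_of_nonneg h5 h40 fun _ => by positivity)
    (fun p => mul_nonneg (h40 _) (by positivity)) hH (fun _ => hH0 _) Prod.snd
  refine (h1.add h2).of_norm_bounded ?_
  rintro ⟨⟨y, x⟩, p⟩
  simp only [norm_mul, norm_zpow, sub_sq_comm p l]
  have hpos : 0 ≤ B * C * B * ‖stepWeight q (binKer q) d y x‖ * ‖q‖ ^ (l - p) ^ 2 := by positivity
  have hpos' : 0 ≤ F y * ‖q‖ ^ |x| *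
      H (p - x) := mul_nonneg (mul_nonneg (h40 _) (by positivity)) (hH0 _)
  rcases lt_or_ge y 0 with hy | hy
  · rw [stepWeight_binKer_neg hq d hy]
    simp only [norm_zero, zero_mul, mul_zero] at hpos ⊢
    linarith
  rcases lt_or_ge (x - p) 0 with hxp | hxp
  · rw [recPoch_neg q hxp]
    simp only [norm_zero, mul_zero]
    linarith
  rcases lt_or_ge (x + p) 0 with hxp' | hxp'
  · rw [gauss_neg q _ hxp']
    simp only [norm_zero, mul_zero, zero_mul]
    linarith
  rcases lt_or_ge (y + l) 0 with hl | hl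
  · refine le_trans ?_ (le_add_of_nonneg_left hpos)
    have hmem : y ∈ Finset.Ico 0 (-l) := Finset.mem_Ico.mpr ⟨hy, by omega⟩
    have h3 : ‖q‖ ^ (tri (-(p - x)) + (l - y) * (-(p - x)) + (l ^ 2 + y ^ 2)) ≤ H (p - x) :=
      Finset.single_le_sum (f := fun y : ℤ =>
        ‖q‖ ^ (tri (-(p - x)) + (l - y) * (-(p - x)) + (l ^ 2 + y ^ 2)))
        (fun _ _ => by positivity) hmem
    have hF : F y = D * B * C' * B := Set.indicator_of_mem (Set.mem_Ico.mpr ⟨hy, by omega⟩) _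
    rw [hF, abs_of_nonneg (by omega)]
    -- The quadratic part in `(x, p)` degenerates to `(x - p)²/2`; along `x = p` the decay comes
    -- from the linear term `x` alone, which is nonnegative because `x ≥ |p|` in this range.
    have h6 : (x - y) ^ 2 + (l - p) ^ 2 + ((y + l) * (x + p) - tri (x + p)) =
        x + (tri (-(p - x)) + (l - y) * (-(p - x)) + (l ^ 2 + y ^ 2)) := by
      refine mul_left_cancel₀ (two_ne_zero (α := ℤ)) ?_
      linear_combination -two_mul_tri (x + p) - two_mul_tri (-(p - x))
    calc _ ≤ D * ‖q‖ ^ (x - y) ^ 2 * (‖q‖ ^ (l - p) ^ 2 * B *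
          (C' * ‖q‖ ^ ((y + l) * (x + p) - tri (x + p)) * B)) := by
          gcongr
          exacts [hD _ _, hB _, hC' _ _ hl, hB _]
      _ = D * B * C' * B *
          ‖q‖ ^ ((x - y) ^ 2 + (l - p) ^ 2 + ((y + l) * (x + p) - tri (x + p))) := by
          rw [zpow_add₀ hρ.ne', zpow_add₀ hρ.ne']; ring
      _ = D * B * C' * B * ‖q‖ ^ x *
          ‖q‖ ^ (tri (-(p - x)) + (l - y) * (-(p - x)) + (l ^ 2 + y ^ 2)) := by
          rw [h6, zpow_add₀ hρ.ne' x]; ring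
      _ ≤ _ := mul_le_mul_of_nonneg_left h3 (by positivity)
  · refine le_trans ?_ (le_add_of_nonneg_right hpos')
    calc _ ≤ ‖stepWeight q (binKer q) d y x‖ * (‖q‖ ^ (l - p) ^ 2 * B * (C * B)) := by
          gcongr
          exacts [hB _, hC _ _ hl, hB _]
      _ = _ := by ring

/-- The kernel identity removes the endpoint `z` of the path and introduces `p`. What is left has
the same shape with `l` in the role of `n` and `p` in the role of `l`. -/
theorem boundedGamma_succ {q : ℂ} (hq0 : q ≠ 0) (hq : ‖q‖ < 1) (d : ℕ) (l n : ℤ) :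
    boundedGamma q (d + 1) l n =
      ∑' p : ℤ, q ^ (l - p) ^ 2 * recPoch q (n - 2 * l + p) * boundedGamma q d p l := by
  have hL := summable_bailey_left hq0 hq d l n
  have hR := summable_bailey_right hq0 hq d l n
  let e : (ℤ × ℤ) × ℤ ≃ (ℤ × ℤ) × ℤ :=
    { toFun := fun s => ((s.2, s.1.1), s.1.2)
      invFun := fun s => ((s.1.2, s.2), s.1.1)
      left_inv := fun _ => rfl
      right_inv := fun _ => rfl }
  calc boundedGamma q (d + 1) l n
      = ∑' (r : ℤ × ℤ) (y : ℤ), stepWeight q (binKer q) d y r.1 *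
          (q ^ (r.2 - r.1) ^ 2 * gaussNat q (y + r.2) (2 * r.1) *
            (gauss q (r.1 + n) (r.2 + l) * recPoch q (r.2 - l))) := by
        refine tsum_congr fun r => ?_
        rw [stepWeight, mul_right_comm, ← tsum_mul_left]
        refine tsum_congr fun y => ?_
        rw [binKer]; ring
    _ = ∑' s : (ℤ × ℤ) × ℤ, stepWeight q (binKer q) d s.1.1 s.1.2 *
          (q ^ (s.2 - s.1.2) ^ 2 * gaussNat q (s.1.1 + s.2) (2 * s.1.2) *
          (gauss q (s.1.2 + n) (s.2 + l) * recPoch q (s.2 - l))) := by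
        exact (e.summable_iff.mpr hL).tsum_prod.symm.trans (e.tsum_eq fun s : (ℤ × ℤ) × ℤ => stepWeight q (binKer q) d s.1.1 s.1.2 *
          (q ^ (s.2 - s.1.2) ^ 2 * gaussNat q (s.1.1 + s.2) (2 * s.1.2) *
          (gauss q (s.1.2 + n) (s.2 + l) * recPoch q (s.2 - l))))
    _ = ∑' (r : ℤ × ℤ) (p : ℤ), stepWeight q (binKer q) d r.1 r.2 *
          (q ^ (l - p) ^ 2 * recPoch q (n - 2 * l + p) *
            (gauss q (r.1 + l) (r.2 + p) * recPoch q (r.2 - p))) := by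
        rw [hL.tsum_prod]
        refine tsum_congr fun r => ?_
        dsimp only
        rw [tsum_mul_left, tsum_mul_left]
        rcases lt_or_ge r.1 0 with h | h
        · rw [stepWeight_binKer_neg hq d h, zero_mul, zero_mul]
        · rw [tsum_bailey_kernel hq0 hq h]
    _ = ∑' (p : ℤ) (r : ℤ × ℤ), stepWeight q (binKer q) d r.1 r.2 *
          (q ^ (l - p) ^ 2 * recPoch q (n - 2 * l + p) *
            (gauss q (r.1 + l) (r.2 + p) * recPoch q (r.2 - p))) :=
        (Summable.tsum_comm (f := fun (r : ℤ × ℤ) (p : ℤ) => stepWeight q (binKer q) d r.1 r.2 *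
          (q ^ (l - p) ^ 2 * recPoch q (n - 2 * l + p) *
            (gauss q (r.1 + l) (r.2 + p) * recPoch q (r.2 - p)))) hR).symm
    _ = _ := by
        refine tsum_congr fun p => ?_
        rw [boundedGamma, ← tsum_mul_left]
        exact tsum_congr fun r => by ring

theorem boundedGamma_zero {q : ℂ} (hq0 : q ≠ 0) (hq : ‖q‖ < 1) (l n : ℤ) :
    boundedGamma q 0 l n = q ^ l ^ 2 * recPoch q (n - 2 * l) := by
  have hinj : Function.Injective fun z : ℤ => ((0 : ℤ), z) := fun a b h => by simpa using h
  rw [boundedGamma, ← hinj.tsum_eq, ← tsum_gauss_mul_recPoch hq0 hq, ← tsum_mul_left,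
    ← (Equiv.addRight l).tsum_eq]
  · refine tsum_congr fun s => ?_
    have e : (s + l) ^ 2 = l ^ 2 + s * (s + 2 * l) := by ring
    have e2 : s + l + l = s + 2 * l := by ring
    simp only [stepWeight, Equiv.coe_addRight, if_true, zero_add, e, e2, add_sub_cancel_right,
      zpow_add₀ hq0 (l ^ 2)]
    ring
  · rintro ⟨x, z⟩ h
    by_cases hx : x = 0
    · exact ⟨z, by rw [hx]⟩
    · simp [stepWeight, hx] at h

theorem exists_norm_etaKer_le {q : ℂ} (hq : ‖q‖ < 1) :
    ∃ C : ℝ, ∀ y x z, ‖etaKer q y x z‖ ≤ C :=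
  let ⟨C, _, _, h⟩ := exists_norm_qPoch_le hq
  ⟨C, fun _ _ _ => h _⟩

theorem exists_norm_binKer_le {q : ℂ} (hq : ‖q‖ < 1) :
    ∃ C : ℝ, ∀ y x z, ‖binKer q y x z‖ ≤ C :=
  let ⟨C, _, h⟩ := exists_norm_gaussNat_le hq
  ⟨C, fun _ _ _ => h _ _⟩

/-- Under the recursion the factor `1/(q)_{l-2p+y}` is exactly the vertex weight `etaKer` at `p`
between `y` and `l`. -/
theorem boundedGamma_eq {q : ℂ} (hq0 : q ≠ 0) (hq : ‖q‖ < 1) (d : ℕ) (l n : ℤ) :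
    boundedGamma q d l n =
      ∑' y : ℤ, recPoch q (n - 2 * l + y) * stepWeight q (etaKer q) d y l := by
  induction d generalizing l n with
  | zero =>
    rw [boundedGamma_zero hq0 hq, tsum_eq_single (0 : ℤ) fun y hy => by simp [stepWeight, hy]]
    simp [stepWeight, mul_comm]
  | succ d ih =>
    rw [boundedGamma_succ hq0 hq]
    refine tsum_congr fun p => ?_
    rw [ih, stepWeight]
    have : ∀ y, recPoch q (l - 2 * p + y) * stepWeight q (etaKer q) d y p =
        etaKer q y p l * stepWeight q (etaKer q) d y p := fun y => by
      rw [etaKer]; congr 2; ring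
    rw [tsum_congr this]
    ring

theorem tendsto_gauss_atTop {q : ℂ} (hq : ‖q‖ < 1) (a k : ℤ) :
    Tendsto (fun n : ℤ => gauss q (a + n) k) atTop (𝓝 (recPoch q k)) := by
  have h0 := qPochInf_ne_zero hq
  have h1 : Tendsto (fun n : ℤ => recPoch q (a + n)) atTop (𝓝 (qPochInf q)⁻¹) :=
    (tendsto_recPoch hq).comp (tendsto_atTop_add_const_left _ a tendsto_id)
  have h2 : Tendsto (fun n : ℤ => recPoch q (a + n - k)) atTop (𝓝 (qPochInf q)⁻¹) :=
    (tendsto_recPoch hq).comp (tendsto_atTop_add_const_right _ (-k)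
      (tendsto_atTop_add_const_left _ a tendsto_id))
  have h3 := (h2.const_mul (recPoch q k)).mul (h1.inv₀ (inv_ne_zero h0))
  rw [inv_inv, inv_mul_cancel_right₀ h0] at h3
  refine h3.congr' ?_
  filter_upwards [eventually_ge_atTop (-a)] with n hn
  rw [← gauss_mul_recPoch hq, mul_inv_cancel_right₀ (recPoch_ne_zero hq (by omega))]

/-- The conjugate Bailey pair of level `d + 1`. -/
theorem conjugate_bailey_pair {q : ℂ} (hq0 : q ≠ 0) (hq : ‖q‖ < 1) (d : ℕ) (l : ℤ) :
    ∑' p : ℤ × ℤ, stepWeight q (binKer q) d p.1 p.2 *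
        (recPoch q (p.2 + l) * recPoch q (p.2 - l)) =
      (qPochInf q)⁻¹ * ∑' y : ℤ, stepWeight q (etaKer q) d y l := by
  obtain ⟨B, hB1, -, hB⟩ := exists_norm_qPoch_le hq
  have hB0 : 0 ≤ B := zero_le_one.trans hB1
  obtain ⟨C, hC0, hC⟩ := exists_norm_gauss_le hq
  obtain ⟨G, hG⟩ := exists_norm_binKer_le hq
  obtain ⟨E, hE⟩ := exists_norm_etaKer_le hq
  obtain ⟨hw, -⟩ := summable_norm_stepWeight hq0 hq hG d
  obtain ⟨hu, -⟩ := summable_norm_stepWeight hq0 hq hE d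
  have hu' : Summable fun y => ‖stepWeight q (etaKer q) d y l‖ := hu.prod_symm.prod_factor l
  have h1 : Tendsto (fun n : ℤ => boundedGamma q d l n) atTop
      (𝓝 (∑' p : ℤ × ℤ, stepWeight q (binKer q) d p.1 p.2 *
        (recPoch q (p.2 + l) * recPoch q (p.2 - l)))) := by
    refine tendsto_tsum_of_dominated_convergence (hw.mul_right (C * B))
      (fun p => ((tendsto_gauss_atTop hq _ _).mul_const _).const_mul _) ?_
    filter_upwards [eventually_ge_atTop 0] with n hn
    rintro ⟨x, z⟩
    -- Negative `x` carry weight `0`; otherwise `x + n ≥ 0`, where Gaussian binomials are uniformly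
    -- bounded.
    rcases lt_or_ge x 0 with hx | hx
    · rw [stepWeight_binKer_neg hq d hx]; simp
    · rw [norm_mul, norm_mul]
      gcongr
      exacts [hC _ _ (by simp only; omega), hB _]
  have h2 : Tendsto (fun n : ℤ => boundedGamma q d l n) atTop
      (𝓝 (∑' y : ℤ, (qPochInf q)⁻¹ * stepWeight q (etaKer q) d y l)) := by
    simp only [boundedGamma_eq hq0 hq]
    refine tendsto_tsum_of_dominated_convergence (hu'.mul_left B) (fun y => ?_) ?_
    · refine Tendsto.mul_const _ ((tendsto_recPoch hq).comp ?_)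
      exact tendsto_atTop_add_const_right _ y (tendsto_atTop_add_const_right _ (-(2 * l)) tendsto_id)
    · refine Eventually.of_forall fun n y => ?_
      rw [norm_mul]
      gcongr
      exact hB _
  rw [tendsto_nhds_unique h1 h2, tsum_mul_left]

/-! ### The Bailey chain of the unit Bailey pair -/

/-- The sequence `α` of the `k`-th Bailey pair in the chain starting from the unit pair. -/
def chainAlpha (q : ℂ) (k : ℕ) (j : ℤ) : ℂ := (-1) ^ j * q ^ (tri (j + 1) + k * j ^ 2)

/-- The sequence `β` of the `k`-th Bailey pair in the chain starting from the unit pair. -/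
def chainBeta (q : ℂ) : ℕ → ℤ → ℂ
  | 0, r => if r = 0 then 1 else 0
  | k + 1, r => ∑' s : ℤ, q ^ s ^ 2 * recPoch q (r - s) * chainBeta q k s

theorem tri_add_one_nonneg (j : ℤ) : 0 ≤ tri (j + 1) := by
  have h := two_mul_tri (j + 1)
  rcases lt_or_ge j 0 with h1 | h1 <;> nlinarith

theorem norm_chainAlpha {q : ℂ} (k : ℕ) (j : ℤ) :
    ‖chainAlpha q k j‖ = ‖q‖ ^ (tri (j + 1) + k * j ^ 2) := by
  simp [chainAlpha]

theorem norm_chainAlpha_le_one {q : ℂ} (hq : ‖q‖ < 1) (k : ℕ) (j : ℤ) :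
    ‖chainAlpha q k j‖ ≤ 1 := by
  have h : 0 ≤ tri (j + 1) + k * j ^ 2 := add_nonneg (tri_add_one_nonneg j) (by positivity)
  obtain ⟨m, hm⟩ := Int.eq_ofNat_of_zero_le h
  rw [norm_chainAlpha, hm, zpow_natCast]
  exact pow_le_one₀ (norm_nonneg _) hq.le

theorem summable_norm_chainAlpha {q : ℂ} (hq0 : q ≠ 0) (hq : ‖q‖ < 1) (k : ℕ) :
    Summable fun j => ‖chainAlpha q k j‖ := by
  simp only [norm_chainAlpha]
  refine summable_zpow_of_quadratic (norm_pos_iff.mpr hq0) hq 1 0 fun s => ?_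
  have : 0 ≤ (k : ℤ) * s ^ 2 := by positivity
  nlinarith [two_mul_tri (s + 1)]

/-- One step of the Bailey chain. After `s ↦ s + j` it is the `q`-Chu–Vandermonde sum with upper
entry `r + j`, multiplied by `1/(q)_{r+j}`. -/
theorem tsum_recPoch_three {q : ℂ} (hq0 : q ≠ 0) (hq : ‖q‖ < 1) (r j : ℤ) :
    ∑' s : ℤ, q ^ s ^ 2 * recPoch q (r - s) * (recPoch q (s - j) * recPoch q (s + j)) =
      q ^ j ^ 2 * (recPoch q (r - j) * recPoch q (r + j)) := by
  have h := tsum_gauss_mul_recPoch hq0 hq (r + j) (2 * j)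
  have e : r + j - 2 * j = r - j := by ring
  rw [e] at h
  rw [← h, ← tsum_mul_right, ← tsum_mul_left, ← (Equiv.addRight j).tsum_eq]
  refine tsum_congr fun s => ?_
  have h1 := gauss_mul_recPoch hq (r + j) (s + 2 * j)
  have e1 : (s + j) ^ 2 = j ^ 2 + s * (s + 2 * j) := by ring
  have e2 : r - (s + j) = r + j - (s + 2 * j) := by ring
  have e3 : s + j + j = s + 2 * j := by ring
  simp only [Equiv.coe_addRight]
  rw [e1, e2, e3, add_sub_cancel_right, zpow_add₀ hq0]
  linear_combination (-(q ^ j ^ 2 * q ^ (s * (s + 2 * j)) * recPoch q s)) * h1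

/-- The reflection `j ↦ -1 - j` fixes `j (j + 1) / 2`, swaps the two `q`-factorials and reverses the
sign. -/
theorem tsum_chainAlpha_zero_shift {q : ℂ} (r : ℤ) :
    ∑' j : ℤ, chainAlpha q 0 j * (recPoch q (r - 1 - j) * recPoch q (r + j)) = 0 := by
  have h : ∑' j : ℤ, chainAlpha q 0 j * (recPoch q (r - 1 - j) * recPoch q (r + j)) =
      -∑' j : ℤ, chainAlpha q 0 j * (recPoch q (r - 1 - j) * recPoch q (r + j)) := by
    conv_lhs => rw [← (Equiv.subLeft (-1 : ℤ)).tsum_eq]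
    rw [← tsum_neg]
    refine tsum_congr fun j => ?_
    simp only [Equiv.subLeft_apply, chainAlpha]
    have e1 : tri (-1 - j + 1) = tri (j + 1) := by
      have := two_mul_tri (-1 - j + 1)
      have := two_mul_tri (j + 1)
      nlinarith
    have e2 : ((-1 : ℂ)) ^ (-1 - j) = -(-1) ^ j := by
      rw [zpow_sub₀ (by norm_num), zpow_neg_one]
      rcases Int.even_or_odd j with h | h
      · rw [h.neg_one_zpow]; norm_num
      · rw [h.neg_one_zpow]; norm_num
    have e3 : r - 1 - (-1 - j) = r + j := by ring
    have e4 : r + (-1 - j) = r - 1 - j := by ring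
    rw [e1, e2, e3, e4]
    simp only [Nat.cast_zero, zero_mul]
    ring
  exact self_eq_neg.mp h

/-- For `r > 0` multiply by `1 - q^(2r) = (1 - q^(r-j)) + q^(r-j) (1 - q^(r+j))`. Each summand
lowers one `q`-factorial and gives a multiple of the vanishing sum `tsum_chainAlpha_zero_shift`, the
second one after `j ↦ j - 1`. -/
theorem tsum_chainAlpha_zero {q : ℂ} (hq0 : q ≠ 0) (hq : ‖q‖ < 1) (r : ℤ) :
    ∑' j : ℤ, chainAlpha q 0 j * (recPoch q (r - j) * recPoch q (r + j)) =
      if r = 0 then 1 else 0 := by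
  obtain ⟨B, hB1, -, hB⟩ := exists_norm_qPoch_le hq
  have hB0 : 0 ≤ B := zero_le_one.trans hB1
  rcases lt_trichotomy r 0 with h | rfl | h
  · rw [if_neg h.ne]
    refine (tsum_congr fun j => ?_).trans tsum_zero
    rcases le_or_gt j 0 with hj | hj
    · rw [recPoch_neg q (by omega : r + j < 0)]; simp
    · rw [recPoch_neg q (by omega : r - j < 0)]; simp
  · rw [if_pos rfl, tsum_eq_single 0]
    · simp [chainAlpha, tri]
    · intro j hj
      rcases lt_or_gt_of_ne hj with hj | hj
      · rw [recPoch_neg q (by omega : 0 + j < 0)]; simp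
      · rw [recPoch_neg q (by omega : 0 - j < 0)]; simp
  · rw [if_neg h.ne']
    have hs : ∀ (a b : ℤ → ℤ), Summable fun j : ℤ =>
        chainAlpha q 0 j * (recPoch q (a j) * recPoch q (b j)) := fun a b => by
      refine ((summable_norm_chainAlpha hq0 hq 0).mul_right (B * B)).of_norm_bounded fun j => ?_
      rw [norm_mul, norm_mul]
      gcongr
      exacts [hB _, hB _]
    have h1 : ∀ j : ℤ, (1 - q ^ (2 * r)) *
          (chainAlpha q 0 j * (recPoch q (r - j) * recPoch q (r + j))) =
        chainAlpha q 0 j * (recPoch q (r - 1 - j) * recPoch q (r + j)) +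
        (-q ^ r) * (chainAlpha q 0 (j - 1) * (recPoch q (r - 1 - (j - 1)) *
          recPoch q (r + (j - 1)))) := fun j => by
      have e1 := recPoch_mul_one_sub hq (r - j)
      have e2 := recPoch_mul_one_sub hq (r + j)
      have e3 : q ^ (2 * r) = q ^ (r - j) * q ^ (r + j) := by
        rw [← zpow_add₀ hq0]; congr 1; ring
      have e4 : r - j - 1 = r - 1 - j := by ring
      have e5 : r + j - 1 = r + (j - 1) := by ring
      have e6 : r - 1 - (j - 1) = r - j := by ring
      have e7 : -q ^ r * chainAlpha q 0 (j - 1) = q ^ (r - j) * chainAlpha q 0 j := by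
        have : q ^ tri (j + 1) = q ^ tri j * q ^ j := by rw [tri_add_one, zpow_add₀ hq0]
        simp only [chainAlpha, Nat.cast_zero, zero_mul, add_zero, sub_add_cancel]
        rw [this, zpow_sub_one₀ (by norm_num), zpow_sub₀ hq0]
        field_simp [zpow_ne_zero j hq0]
      rw [e4] at e1
      rw [e5] at e2
      rw [e6, ← e1, ← mul_assoc (-q ^ r), e7, ← e2, e3]
      ring
    have h2 := (Equiv.subRight (1 : ℤ)).tsum_eq fun j : ℤ =>
      chainAlpha q 0 j * (recPoch q (r - 1 - j) * recPoch q (r + j))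
    simp only [Equiv.subRight_apply] at h2
    have h3 : (1 - q ^ (2 * r)) * ∑' j : ℤ,
        chainAlpha q 0 j * (recPoch q (r - j) * recPoch q (r + j)) = 0 := by
      have h4 := (Equiv.subRight (1 : ℤ)).summable_iff.mpr (hs (fun j => r - 1 - j) fun j => r + j)
      simp only [Function.comp_def, Equiv.subRight_apply] at h4
      rw [← tsum_mul_left, tsum_congr h1, (hs (fun j => r - 1 - j) fun j => r + j).tsum_add
        (h4.mul_left _), tsum_mul_left, h2, tsum_chainAlpha_zero_shift]
      ring
    refine (mul_eq_zero.mp h3).resolve_left ?_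
    obtain ⟨m, hm⟩ : ∃ m : ℕ, 2 * r = ((m + 1 : ℕ) : ℤ) := ⟨(2 * r - 1).toNat, by omega⟩
    rw [hm, zpow_natCast]
    exact one_sub_pow_ne_zero hq m

/-- The Bailey pair `(chainAlpha q k, chainBeta q k)` relative to `1`. -/
theorem chainBeta_eq {q : ℂ} (hq0 : q ≠ 0) (hq : ‖q‖ < 1) (k : ℕ) (r : ℤ) :
    chainBeta q k r =
      ∑' j : ℤ, chainAlpha q k j * (recPoch q (r - j) * recPoch q (r + j)) := by
  obtain ⟨B, hB1, -, hB⟩ := exists_norm_qPoch_le hq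
  have hB0 : 0 ≤ B := zero_le_one.trans hB1
  induction k generalizing r with
  | zero => rw [tsum_chainAlpha_zero hq0 hq]; rfl
  | succ k ih =>
    have hs : Summable (Function.uncurry fun (s j : ℤ) => chainAlpha q k j *
        (q ^ s ^ 2 * recPoch q (r - s) * (recPoch q (s - j) * recPoch q (s + j)))) := by
      have h1 := ((summable_zpow_sq (norm_pos_iff.mpr hq0) hq).mul_of_nonneg
        (summable_norm_chainAlpha hq0 hq k) (fun _ => by positivity)
        fun _ => norm_nonneg _).mul_right (B * (B * B))
      refine h1.of_norm_bounded ?_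
      rintro ⟨s, j⟩
      simp only [Function.uncurry_apply_pair, norm_mul, norm_zpow]
      calc _ ≤ ‖chainAlpha q k j‖ * (‖q‖ ^ s ^ 2 * B * (B * B)) := by
            gcongr
            exacts [hB _, hB _, hB _]
        _ = _ := by ring
    have h2 : ∀ s, q ^ s ^ 2 * recPoch q (r - s) * chainBeta q k s = ∑' j, chainAlpha q k j *
        (q ^ s ^ 2 * recPoch q (r - s) * (recPoch q (s - j) * recPoch q (s + j))) := fun s => by
      rw [ih, ← tsum_mul_left]
      exact tsum_congr fun j => by ring
    rw [chainBeta, tsum_congr h2, ← hs.tsum_comm]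
    refine tsum_congr fun j => ?_
    rw [tsum_mul_left, tsum_recPoch_three hq0 hq, ← mul_assoc]
    congr 1
    rw [chainAlpha, chainAlpha, mul_assoc, ← zpow_add₀ hq0]
    congr 2
    push_cast; ring

theorem chainBeta_neg (q : ℂ) (k : ℕ) {r : ℤ} (hr : r < 0) : chainBeta q k r = 0 := by
  induction k generalizing r with
  | zero => simp [chainBeta, hr.ne]
  | succ k ih =>
    refine (tsum_congr fun s => ?_).trans tsum_zero
    rcases lt_or_ge s 0 with hs | hs
    · rw [ih hs, mul_zero]
    · rw [recPoch_neg q (by omega : r - s < 0)]; simp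

theorem tsum_natCast_of_neg {f : ℤ → ℂ} (hf : ∀ r < 0, f r = 0) :
    ∑' r : ℕ, f r = ∑' r : ℤ, f r :=
  Nat.cast_injective.tsum_eq fun r hr => by
    by_contra h
    exact hr (hf r (by_contra fun h' => h ⟨r.toNat, by simp; omega⟩))

/-- The sequence `δ` of the conjugate Bailey pair of level `d + 1`. -/
def levelDelta (q : ℂ) (d : ℕ) (r : ℤ) : ℂ := ∑' x, stepWeight q (binKer q) d x r

theorem summable_norm_levelDelta {q : ℂ} (hq0 : q ≠ 0) (hq : ‖q‖ < 1) (d : ℕ) :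
    Summable fun r => ‖levelDelta q d r‖ := by
  obtain ⟨G, hG⟩ := exists_norm_binKer_le hq
  have hw := (summable_norm_stepWeight hq0 hq hG d).1.prod_symm
  exact hw.prod.of_nonneg_of_le (fun _ => norm_nonneg _) fun r =>
    norm_tsum_le_tsum_norm (hw.prod_factor r)

/-- Bailey's transform for the pair of the `k`-th chain and the conjugate pair of level `d + 1`. -/
theorem tsum_levelDelta_mul_chainBeta {q : ℂ} (hq0 : q ≠ 0) (hq : ‖q‖ < 1) (d k : ℕ) :
    ∑' r : ℕ, levelDelta q d r * chainBeta q k r =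
      (qPochInf q)⁻¹ * ∑' j, chainAlpha q k j * ∑' y, stepWeight q (etaKer q) d y j := by
  obtain ⟨B, hB1, -, hB⟩ := exists_norm_qPoch_le hq
  have hB0 : 0 ≤ B := zero_le_one.trans hB1
  obtain ⟨G, hG⟩ := exists_norm_binKer_le hq
  have hw := (summable_norm_stepWeight hq0 hq hG d).1
  have hδ := summable_norm_levelDelta hq0 hq d
  have hs : Summable (Function.uncurry fun (r j : ℤ) => levelDelta q d r *
      (chainAlpha q k j * (recPoch q (r - j) * recPoch q (r + j)))) := by
    have h1 := (hδ.mul_of_nonneg (summable_norm_chainAlpha hq0 hq k) (fun _ => norm_nonneg _)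
        fun _ => norm_nonneg _).mul_right (B * B)
    refine h1.of_norm_bounded ?_
    rintro ⟨r, j⟩
    simp only [Function.uncurry_apply_pair, norm_mul]
    calc _ ≤ ‖levelDelta q d r‖ * (‖chainAlpha q k j‖ * (B * B)) := by
          gcongr
          exacts [hB _, hB _]
      _ = _ := by ring
  rw [tsum_natCast_of_neg (f := fun r => levelDelta q d r * chainBeta q k r)
    fun r hr => by rw [chainBeta_neg q k hr, mul_zero]]
  simp only [chainBeta_eq hq0 hq, ← tsum_mul_left]
  rw [← hs.tsum_comm]
  refine tsum_congr fun j => ?_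
  have h2 : Summable fun p : ℤ × ℤ => stepWeight q (binKer q) d p.2 p.1 *
      (recPoch q (p.1 + j) * recPoch q (p.1 - j)) := by
    refine (hw.prod_symm.mul_right (B * B)).of_norm_bounded fun p => ?_
    rw [norm_mul, norm_mul]
    refine mul_le_mul_of_nonneg_left ?_ (norm_nonneg _)
    gcongr
    exacts [hB _, hB _]
  have h3 := conjugate_bailey_pair hq0 hq d j
  rw [← (Equiv.prodComm ℤ ℤ).tsum_eq] at h3
  simp only [Equiv.prodComm_apply, Prod.fst_swap, Prod.snd_swap] at h3
  rw [h2.tsum_prod] at h3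
  simp only [tsum_mul_left] at h3 ⊢
  rw [mul_left_comm, ← h3, ← tsum_mul_left]
  refine tsum_congr fun r => ?_
  rw [tsum_mul_right, levelDelta]
  ring

/-! ### Unrolling the Bailey chain -/

/-- The weight of a sequence `x ≥ r_1 ≥ … ≥ r_k ≥ 0`, vanishing if the sequence is not decreasing. -/
def chainWeight (q : ℂ) : (k : ℕ) → ℤ → (Fin k → ℕ) → ℂ
  | 0, x, _ => recPoch q x
  | k + 1, x, r => q ^ (r 0 : ℤ) ^ 2 * recPoch q (x - r 0) * chainWeight q k (r 0) (Fin.tail r)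

/-- The majorant is uniform in `x`, so it can be multiplied with any summable weight of `x`. -/
theorem exists_norm_chainWeight_le {q : ℂ} (hq0 : q ≠ 0) (hq : ‖q‖ < 1) (k : ℕ) :
    ∃ g : (Fin k → ℕ) → ℝ, Summable g ∧ (∀ r, 0 ≤ g r) ∧ ∀ x r, ‖chainWeight q k x r‖ ≤ g r := by
  obtain ⟨B, hB1, -, hB⟩ := exists_norm_qPoch_le hq
  have hB0 : 0 ≤ B := zero_le_one.trans hB1
  induction k with
  | zero => exact ⟨fun _ => B, (hasSum_fintype _).summable, fun _ => hB0, fun x _ => hB x⟩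
  | succ k ih =>
    obtain ⟨g, hg, hg0, hgb⟩ := ih
    have h1 : Summable fun s : ℕ => ‖q‖ ^ (s : ℤ) ^ 2 * B :=
      ((summable_zpow_sq (norm_pos_iff.mpr hq0) hq).comp_injective Nat.cast_injective).mul_right B
    have h2 := h1.mul_of_nonneg hg (fun _ => by positivity) hg0
    refine ⟨fun r => ‖q‖ ^ (r 0 : ℤ) ^ 2 * B * g (Fin.tail r), ?_, fun r =>
      mul_nonneg (by positivity) (hg0 _), fun x r => ?_⟩
    · refine (Fin.consEquiv fun _ => ℕ).summable_iff.mp (h2.congr ?_)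
      rintro ⟨s, r⟩
      simp [Fin.consEquiv]
    · rw [chainWeight, norm_mul, norm_mul, norm_zpow]
      exact mul_le_mul (mul_le_mul_of_nonneg_left (hB _) (by positivity)) (hgb _ _)
        (norm_nonneg _) (by positivity)

theorem tsum_cons {k : ℕ} {f : (Fin (k + 1) → ℕ) → ℂ} (hf : Summable f) :
    ∑' r, f r = ∑' (s : ℕ) (r : Fin k → ℕ), f (Fin.cons s r) := by
  have h := (Fin.consEquiv fun _ : Fin (k + 1) => ℕ).summable_iff.mpr hf
  exact ((Fin.consEquiv fun _ : Fin (k + 1) => ℕ).tsum_eq f).symm.trans h.tsum_prod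

/-- The last factor `1/(q)_{r_k}` is itself a chain step applied to the unit `β`, which explains `k
+ 1` steps for `k` summation variables. -/
theorem tsum_chainWeight {q : ℂ} (hq0 : q ≠ 0) (hq : ‖q‖ < 1) (k : ℕ) (x : ℤ) :
    ∑' r, chainWeight q k x r = chainBeta q (k + 1) x := by
  induction k generalizing x with
  | zero =>
    rw [tsum_eq_single (default : Fin 0 → ℕ) fun K hK => (hK (Subsingleton.elim _ _)).elim,
      chainBeta, tsum_eq_single 0 fun s hs => by simp [chainBeta, hs]]
    simp [chainWeight, chainBeta]
  | succ k ih =>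
    obtain ⟨g, hg, -, hgb⟩ := exists_norm_chainWeight_le hq0 hq (k + 1)
    rw [tsum_cons (hg.of_norm_bounded (hgb x)), chainBeta, ← tsum_natCast_of_neg]
    · refine tsum_congr fun s => ?_
      simp only [chainWeight, Fin.cons_zero, Fin.tail_cons]
      rw [tsum_mul_left, ih]
    · intro r hr
      rw [chainBeta_neg q _ hr, mul_zero]

/-- The square of the largest part is absent: it belongs to the conjugate pair, in the form `r_1² /
N`. An arbitrary extension `p` survives the index shift in the induction. -/
theorem chainWeight_eq_prod {q : ℂ} (hq0 : q ≠ 0) (k : ℕ) (r : Fin (k + 1) → ℕ) (p : ℕ → ℕ)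
    (hp : ∀ i : Fin (k + 1), p i = r i) (hp' : p (k + 1) = 0) :
    chainWeight q k (r 0) (Fin.tail r) =
      q ^ (∑ i ∈ Finset.range k, (p (i + 1) : ℤ) ^ 2) *
        ∏ i ∈ Finset.range (k + 1), recPoch q ((p i : ℤ) - p (i + 1)) := by
  induction k generalizing p with
  | zero => simp [chainWeight, hp', ← hp 0]
  | succ k ih =>
    have h := ih (Fin.tail r) (fun i => p (i + 1))
      (fun i => by simpa [Fin.tail] using hp i.succ) hp'
    have h0 : p 0 = r 0 := hp 0
    have h1 : p 1 = Fin.tail r 0 := hp 1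
    rw [chainWeight, h, Finset.prod_range_succ' _ (k + 1), Finset.sum_range_succ', zpow_add₀ hq0,
      ← h1, ← h0]
    simp only [zero_add]
    ring

section Cartan

open Matrix

/-! ### The inverse Cartan matrix and convex integer paths -/

/-- The value `f N` is cut off rather than assumed to vanish: in the `(m, n)`-system `f N = 2L`, and
the missing term is the inhomogeneity `2L e_{N-1}`. -/
theorem incidence_mulVec (N : ℕ) (f : ℕ → ℚ) (h0 : f 0 = 0) (i : Fin (N - 1)) :
    (incidence N *ᵥ fun j => f (j + 1)) i = f i + if (i : ℕ) + 2 < N then f (i + 2) else 0 := by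
  have hi := i.2
  simp only [Matrix.mulVec, dotProduct, incidence, Matrix.of_apply]
  rw [Fin.sum_univ_eq_sum_range (fun j => ((if (i : ℕ) + 1 = j then (1 : ℚ) else 0) +
    (if (i : ℕ) = j + 1 then 1 else 0)) * f (j + 1)) (N - 1)]
  simp only [add_mul, ite_mul, one_mul, zero_mul, Finset.sum_add_distrib, Finset.sum_ite_eq,
    Finset.mem_range]
  have h1 : ∑ j ∈ Finset.range (N - 1), (if (i : ℕ) = j + 1 then f (j + 1) else 0) = f i := by
    rcases Nat.eq_zero_or_pos (i : ℕ) with hz | hz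
    · rw [hz, h0]; exact Finset.sum_eq_zero fun j _ => if_neg (by omega)
    · rw [Finset.sum_eq_single ((i : ℕ) - 1)]
      · rw [if_pos (by omega)]; congr 1; omega
      · intro j _ hj; exact if_neg (by omega)
      · intro h; exact absurd (Finset.mem_range.mpr (by omega)) h
  rw [h1, add_comm]
  congr 1
  by_cases h : (i : ℕ) + 2 < N
  · rw [if_pos h, if_pos (by omega)]
  · rw [if_neg h, if_neg (by omega)]

theorem cartan_mulVec (N : ℕ) (f : ℕ → ℚ) (h0 : f 0 = 0) (hN : f N = 0) :
    (cartan N *ᵥ fun j => f (j + 1)) = fun i : Fin (N - 1) => 2 * f (i + 1) - f i - f (i + 2) := by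
  ext i
  have hi := i.2
  rw [cartan_eq, Matrix.sub_mulVec, Pi.sub_apply, incidence_mulVec N f h0, Matrix.smul_mulVec,
    Matrix.one_mulVec]
  simp only [Pi.smul_apply, smul_eq_mul]
  by_cases h : (i : ℕ) + 2 < N
  · rw [if_pos h]; ring
  · have : (i : ℕ) + 2 = N := by omega
    rw [if_neg h, this, hN]; ring

theorem isUnit_det_cartan (N : ℕ) : IsUnit (cartan N).det := by
  -- The Green's function `min(i, j) - i j / N` of the discrete Laplacian with zero boundary values.
  refine Matrix.isUnit_det_of_right_inverse (B := Matrix.of fun i j : Fin (N - 1) =>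
    (min ((i : ℕ) + 1) ((j : ℕ) + 1) : ℕ) - ((i : ℕ) + 1 : ℕ) * ((j : ℕ) + 1 : ℚ) / N) ?_
  ext i j
  have hi := i.2
  have hj := j.2
  have hN : (N : ℚ) ≠ 0 := by
    have : N ≠ 0 := by omega
    exact_mod_cast this
  have h := congrFun (cartan_mulVec N
    (fun a => (min a ((j : ℕ) + 1) : ℕ) - (a : ℕ) * ((j : ℕ) + 1 : ℚ) / N) (by simp) (by
      rw [min_eq_right (by omega)]; push_cast; field_simp; ring)) i
  refine h.trans ?_
  rw [Matrix.one_apply]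
  rcases lt_trichotomy (i : ℕ) j with hij | hij | hij
  · rw [if_neg (fun h => by simp [h] at hij), min_eq_left (by omega), min_eq_left (by omega),
      min_eq_left (by omega)]
    push_cast; ring
  · rw [if_pos (Fin.ext hij), hij, min_eq_left (by omega), min_eq_left (by omega),
      min_eq_right (by omega)]
    push_cast; ring
  · rw [if_neg (fun h => by simp [h] at hij), min_eq_right (by omega), min_eq_right (by omega),
      min_eq_right (by omega)]
    push_cast; ring

/-- `C⁻¹ v` for `v` the second difference of a path from `0` to `K N`. -/
theorem cartan_inv_mulVec {N : ℕ} (hN : 1 ≤ N) (K : ℕ → ℚ) (h0 : K 0 = 0)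
    {v : Fin (N - 1) → ℚ} (hv : ∀ i : Fin (N - 1), v i = K i - 2 * K (i + 1) + K (i + 2)) :
    (cartan N)⁻¹ *ᵥ v = fun i : Fin (N - 1) => K N * ((i : ℕ) + 1 : ℕ) / N - K (i + 1) := by
  have hN0 : (N : ℚ) ≠ 0 := by
    have : N ≠ 0 := by omega
    exact_mod_cast this
  -- Chord minus path vanishes at both ends, and the chord has no second difference.
  have h := cartan_mulVec N (fun a => K N * (a : ℕ) / N - K a) (by simp [h0])
    (by field_simp; ring)
  have h2 : v = cartan N *ᵥ fun i : Fin (N - 1) => K N * ((i : ℕ) + 1 : ℕ) / N - K (i + 1) := by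
    rw [h]
    ext i
    rw [hv]
    push_cast; ring
  rw [h2, Matrix.mulVec_mulVec, Matrix.nonsing_inv_mul _ (isUnit_det_cartan N), Matrix.one_mulVec]

theorem sum_secondDiff_mul (K u : ℕ → ℚ) (d : ℕ) :
    ∑ i ∈ Finset.range d, (K i - 2 * K (i + 1) + K (i + 2)) * u (i + 1) =
      (K (d + 1) - K d) * u (d + 1) - (K 1 - K 0) * u 0 -
        ∑ i ∈ Finset.range (d + 1), (K (i + 1) - K i) * (u (i + 1) - u i) := by
  induction d with
  | zero => simp; ring
  | succ d ih =>
    rw [Finset.sum_range_succ, ih, Finset.sum_range_succ _ (d + 1)]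
    ring

/-- The quadratic form `v C⁻¹ v` for `v` the second difference of a path from `0` to `K N`. -/
theorem quadForm_eq {N : ℕ} (hN : 1 ≤ N) (K : ℕ → ℚ) (h0 : K 0 = 0) {v : Fin (N - 1) → ℕ}
    (hv : ∀ i : Fin (N - 1), (v i : ℚ) = K i - 2 * K (i + 1) + K (i + 2)) :
    quadForm N v = ∑ i ∈ Finset.range N, (K (i + 1) - K i) ^ 2 - K N ^ 2 / N := by
  have hN0 : (N : ℚ) ≠ 0 := by
    have : N ≠ 0 := by omega
    exact_mod_cast this
  have hN1 : N - 1 + 1 = N := by omega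
  rw [quadForm, cartan_inv_mulVec hN K h0 (v := toRat v) hv, dotProduct]
  simp only [toRat, hv]
  rw [Fin.sum_univ_eq_sum_range (fun i => (K i - 2 * K (i + 1) + K (i + 2)) *
    (K N * (i + 1 : ℕ) / N - K (i + 1))) (N - 1),
    sum_secondDiff_mul K (fun a => K N * (a : ℕ) / N - K a), hN1, h0]
  -- After summation by parts the boundary terms vanish, and the cross terms telescope to `K N ^ 2 /
  -- N`.
  have h1 : ∀ i : ℕ, (K (i + 1) - K i) * (K N * ((i + 1 : ℕ) : ℚ) / N - K (i + 1) -
      (K N * (i : ℕ) / N - K i)) = (K N / N) * (K (i + 1) - K i) - (K (i + 1) - K i) ^ 2 := by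
    intro i; push_cast; ring
  simp only [h1]
  rw [Finset.sum_sub_distrib, ← Finset.mul_sum, Finset.sum_range_sub, h0]
  field_simp
  push_cast
  ring

theorem unitVec_one_dotProduct {N : ℕ} (hN : 1 ≤ N) (K : ℕ → ℚ) (h0 : K 0 = 0)
    {v : Fin (N - 1) → ℚ} (hv : ∀ i : Fin (N - 1), v i = K i - 2 * K (i + 1) + K (i + 2)) :
    unitVec N 1 ⬝ᵥ ((cartan N)⁻¹ *ᵥ v) = K N / N - K 1 := by
  rw [cartan_inv_mulVec hN K h0 hv, dotProduct]
  rcases Nat.lt_or_ge 1 N with h | h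
  · rw [Finset.sum_eq_single (⟨0, by omega⟩ : Fin (N - 1))]
    · simp [unitVec]
    · intro i _ hi
      have : ¬ ((i : ℕ) + 1 = 1) := fun h => hi (Fin.ext (by simpa using h))
      rw [unitVec, if_neg this, zero_mul]
    · simp
  · obtain rfl : N = 1 := by omega
    simp

/-! ### Bijections between convex integer paths and the summation vectors. -/

/-- The second difference of the path `0, K_1, …, K_d, L`. -/
def secondDiff {d : ℕ} (K : Fin d → ℤ) (L : ℤ) (i : ℕ) : ℤ :=
  pathExt K L i - 2 * pathExt K L (i + 1) + pathExt K L (i + 2)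

theorem pathExt_eq {N : ℕ} (hN : 1 ≤ N) (K : Fin (N - 1) → ℤ) (L : ℤ) : pathExt K L N = L := by
  have := pathExt_last K L
  rwa [Nat.sub_add_cancel hN] at this

/-- Convex integer paths from `0` to `L` with `N` steps. -/
def etaPaths (N : ℕ) (L : ℤ) : Set (Fin (N - 1) → ℤ) := {K | ∀ i < N - 1, 0 ≤ secondDiff K L i}

/-- Convex nonnegative integer paths from `0` to `L` with `N` steps. -/
def mnPaths (N : ℕ) (L : ℤ) : Set (Fin (N - 1) → ℤ) := {K | (∀ i, 0 ≤ K i) ∧ K ∈ etaPaths N L}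

/-- The vector of second differences of a convex path. -/
def diffVec {N : ℕ} (K : Fin (N - 1) → ℤ) (L : ℤ) : Fin (N - 1) → ℕ :=
  fun i => (secondDiff K L i).toNat

theorem diffVec_cast {N : ℕ} {L : ℤ} {K : Fin (N - 1) → ℤ} (hK : K ∈ etaPaths N L)
    (i : Fin (N - 1)) : ((diffVec K L i : ℕ) : ℤ) = secondDiff K L i :=
  Int.toNat_of_nonneg (hK i i.2)

theorem toRat_diffVec {N : ℕ} {L : ℤ} {K : Fin (N - 1) → ℤ} (hK : K ∈ etaPaths N L)
    (i : Fin (N - 1)) : ((diffVec K L i : ℕ) : ℚ) =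
      (pathExt K L i : ℚ) - 2 * (pathExt K L (i + 1) : ℚ) + (pathExt K L (i + 2) : ℚ) := by
  have := diffVec_cast hK i
  rw [secondDiff] at this
  exact_mod_cast this

theorem integralShift_diffVec {N : ℕ} (hN : 1 ≤ N) {L : ℤ} {K : Fin (N - 1) → ℤ}
    (hK : K ∈ etaPaths N L) : IntegralShift N L (diffVec K L) := by
  refine ⟨pathExt K L 1, ?_⟩
  rw [unitVec_one_dotProduct hN (fun i => (pathExt K L i : ℚ)) (by simp)
    (v := toRat (diffVec K L)) (toRat_diffVec hK), pathExt_eq hN]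
  ring

theorem quadForm_diffVec {N : ℕ} (hN : 1 ≤ N) {L : ℤ} {K : Fin (N - 1) → ℤ}
    (hK : K ∈ etaPaths N L) : (L : ℚ) ^ 2 / N + quadForm N (diffVec K L) =
      ((∑ i ∈ Finset.range (N - 1 + 1), (pathExt K L (i + 1) - pathExt K L i) ^ 2 : ℤ) : ℚ) := by
  rw [quadForm_eq hN (fun i => (pathExt K L i : ℚ)) (by simp) (toRat_diffVec hK), pathExt_eq hN,
    Nat.sub_add_cancel hN]
  push_cast
  ring

theorem eq_of_secondDiff_eq {N : ℕ} (hN : 1 ≤ N) {K K' : ℕ → ℚ} (h0 : K 0 = 0) (h0' : K' 0 = 0)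
    (hL : K N = K' N) (h : ∀ i < N - 1, K i - 2 * K (i + 1) + K (i + 2) =
      K' i - 2 * K' (i + 1) + K' (i + 2)) (i : Fin (N - 1)) : K (i + 1) = K' (i + 1) := by
  have h1 := cartan_inv_mulVec hN K h0 (v := fun i => K i - 2 * K (i + 1) + K (i + 2)) fun _ => rfl
  have h2 := cartan_inv_mulVec hN K' h0' (v := fun i => K i - 2 * K (i + 1) + K (i + 2))
    fun i => h i i.2
  have h3 := congrFun (h1.symm.trans h2) i
  simp only [hL] at h3
  linarith

theorem diffVec_injOn {N : ℕ} (hN : 1 ≤ N) {L : ℤ} {K K' : Fin (N - 1) → ℤ}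
    (hK : K ∈ etaPaths N L) (hK' : K' ∈ etaPaths N L) (h : diffVec K L = diffVec K' L) :
    K = K' := by
  ext i
  have h1 := eq_of_secondDiff_eq hN (K := fun i => (pathExt K L i : ℚ))
    (K' := fun i => (pathExt K' L i : ℚ)) (by simp) (by simp) (by simp [pathExt_eq hN])
    (fun j hj => by
      rw [← toRat_diffVec hK ⟨j, hj⟩, ← toRat_diffVec hK' ⟨j, hj⟩, h]) i
  simp only [pathExt_succ _ _ i.2] at h1
  exact_mod_cast h1

/-- The sequence with initial values `0`, `z` and second differences `v`. -/
def secondSum (z : ℤ) (v : ℕ → ℤ) : ℕ → ℤ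
  | 0 => 0
  | 1 => z
  | n + 2 => v n + 2 * secondSum z v (n + 1) - secondSum z v n

/-- The integer provided by the integrality condition serves as the first vertex, and `v` determines
the rest of the path. Comparing `(C⁻¹ v)_1 = S N / N - S 1` with the condition forces the endpoint
to be `L`. -/
theorem exists_diffVec_eq {N : ℕ} (hN : 1 ≤ N) {L : ℤ} {v : Fin (N - 1) → ℕ}
    (hv : IntegralShift N L v) : ∃ K ∈ etaPaths N L, diffVec K L = v := by
  obtain ⟨z, hz⟩ := hv
  have hN0 : (N : ℚ) ≠ 0 := by
    have : N ≠ 0 := by omega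
    exact_mod_cast this
  let S := secondSum z fun i => if h : i < N - 1 then (v ⟨i, h⟩ : ℤ) else 0
  have hS : ∀ i : Fin (N - 1), (v i : ℤ) = S i - 2 * S (i + 1) + S (i + 2) := fun i => by
    have : S (i + 2) = (if h : (i : ℕ) < N - 1 then (v ⟨i, h⟩ : ℤ) else 0) + 2 * S (i + 1) - S i :=
      rfl
    rw [this, dif_pos i.2]
    ring
  have h1 := unitVec_one_dotProduct hN (fun i => (S i : ℚ)) (by simp [S, secondSum])
    (v := toRat v) (fun i => by have := hS i; simp only [toRat]; exact_mod_cast this)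
  rw [h1] at hz
  have hS1 : S 1 = z := rfl
  have hSN : S N = L := by
    have : (L : ℚ) / N = S N / N := by rw [hS1] at hz; linarith
    rw [div_left_inj' hN0] at this
    exact_mod_cast this.symm
  have hext : ∀ i ≤ N, pathExt (fun i : Fin (N - 1) => S (i + 1)) L i = S i := fun i hi => by
    rcases i with _ | i
    · simp [S, secondSum]
    · rcases Nat.lt_or_ge i (N - 1) with h | h
      · rw [pathExt_succ _ _ h]
      · have : i + 1 = N := by omega
        rw [this, pathExt_eq hN, hSN]
  have hd : ∀ i : Fin (N - 1), secondDiff (fun i : Fin (N - 1) => S (i + 1)) L i = v i :=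
    fun i => by
      have := i.2
      rw [secondDiff, hext _ (by omega), hext _ (by omega), hext _ (by omega), hS]
  refine ⟨fun i => S (i + 1), fun i hi => ?_, ?_⟩
  · rw [hd ⟨i, hi⟩]; positivity
  · ext i
    rw [diffVec, hd, Int.toNat_natCast]

/-- Convex paths correspond to the vectors `η`. -/
def etaEquiv {N : ℕ} (hN : 1 ≤ N) (L : ℤ) : etaPaths N L ≃ EtaIndex N L :=
  Equiv.ofBijective (fun K => ⟨diffVec K.1 L, integralShift_diffVec hN K.2⟩) <| by
    constructor
    · intro K K' h
      exact Subtype.ext (diffVec_injOn hN K.2 K'.2 (congrArg Subtype.val h))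
    · rintro ⟨v, hv⟩
      obtain ⟨K, hK, rfl⟩ := exists_diffVec_eq hN hv
      exact ⟨⟨K, hK⟩, rfl⟩

theorem mnSystem_iff {N : ℕ} (L : ℕ) (m n : Fin (N - 1) → ℕ) (f : ℕ → ℚ) (h0 : f 0 = 0)
    (hf : ∀ i : Fin (N - 1), f (i + 1) = m i) (hN : f N = 2 * L) :
    MNSystem N L m n ↔ ∀ i : Fin (N - 1), (n i : ℚ) = f i / 2 - 2 * (f (i + 1) / 2) +
      f (i + 2) / 2 := by
  have hm : toRat m = fun i : Fin (N - 1) => f (i + 1) := by ext i; simp [toRat, hf]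
  rw [MNSystem, funext_iff]
  refine forall_congr' fun i => ?_
  have hi := i.2
  rw [hm]
  simp only [Pi.add_apply, Pi.smul_apply, smul_eq_mul, incidence_mulVec N f h0, toRat, unitVec]
  by_cases h : (i : ℕ) + 2 < N
  · rw [if_pos h, if_neg (by omega)]
    constructor <;> intro h <;> linarith
  · have h2 : (i : ℕ) + 2 = N := by omega
    rw [if_neg h, if_pos (by omega), h2, hN]
    constructor <;> intro h <;> linarith

theorem mnSystem_diffVec {N : ℕ} (hN : 1 ≤ N) {L : ℕ} {K : Fin (N - 1) → ℤ}
    (hK : K ∈ mnPaths N L) : MNSystem N L (fun i => (2 * K i).toNat) (diffVec K L) := by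
  refine (mnSystem_iff L _ _ (fun i => 2 * (pathExt K L i : ℚ)) (by simp) (fun i => ?_)
    (by simp [pathExt_eq hN])).mpr fun i => ?_
  · have h : (((2 * K i).toNat : ℕ) : ℤ) = 2 * K i :=
      Int.toNat_of_nonneg (by have := hK.1 i; omega)
    rw [pathExt_succ _ _ i.2]
    exact_mod_cast h.symm
  · rw [toRat_diffVec hK.2]; ring

/-- Both `m / 2` and `K` are paths from `0` to `L` with second differences `n`, hence equal. In
particular such an `m` is even and `K` is nonnegative. -/
theorem eq_two_mul_of_mnSystem {N : ℕ} (hN : 1 ≤ N) {L : ℕ} {m n : Fin (N - 1) → ℕ}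
    (h : MNSystem N L m n) {K : Fin (N - 1) → ℤ} (hK : K ∈ etaPaths N L)
    (hn : diffVec K L = n) (i : Fin (N - 1)) : (m i : ℤ) = 2 * K i := by
  let f : ℕ → ℚ := fun i => (pathExt (fun i => (m i : ℤ)) (2 * L) i : ℚ)
  have hf := (mnSystem_iff L m n f (by simp [f]) (fun i => by simp [f, pathExt_succ _ _ i.2])
    (by simp [f, pathExt_eq hN])).mp h
  have h1 := eq_of_secondDiff_eq hN (K := fun i => f i / 2)
    (K' := fun i => (pathExt K L i : ℚ)) (by simp [f]) (by simp) (by simp [f, pathExt_eq hN])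
    (fun j hj => by rw [← toRat_diffVec hK ⟨j, hj⟩, hn, hf]) i
  simp only [pathExt_succ _ _ i.2, f] at h1
  have h2 : (m i : ℚ) = 2 * K i := by push_cast at h1; linarith
  exact_mod_cast h2

/-- Nonnegative convex paths correspond to the solutions of the `(m, n)`-system. -/
def mnEquiv {N : ℕ} (hN : 1 ≤ N) (L : ℕ) : mnPaths N L ≃ MNIndex N L :=
  Equiv.ofBijective (fun K => ⟨(fun i => (2 * K.1 i).toNat, diffVec K.1 L),
    integralShift_diffVec hN K.2.2, mnSystem_diffVec hN K.2⟩) <| by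
    constructor
    · intro K K' h
      exact Subtype.ext (diffVec_injOn hN K.2.2 K'.2.2 (congrArg (fun p => p.1.2) h))
    · rintro ⟨⟨m, n⟩, hs, hmn⟩
      obtain ⟨K, hK, rfl⟩ := exists_diffVec_eq hN hs
      have hm := eq_two_mul_of_mnSystem hN hmn hK rfl
      refine ⟨⟨K, fun i => by have := hm i; omega, hK⟩, Subtype.ext (Prod.ext ?_ rfl)⟩
      ext i
      simp [← hm i]

end Cartan

/-! ### Translation of the two sides -/

theorem qPow_add {q : ℂ} (hq0 : q ≠ 0) (x y : ℚ) : qPow q (x + y) = qPow q x * qPow q y := by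
  rw [qPow, qPow, qPow, ← Complex.cpow_add _ _ hq0]
  push_cast
  rfl

theorem qPow_intCast (q : ℂ) (n : ℤ) : qPow q n = q ^ n := by
  rw [qPow, ← Complex.cpow_intCast]
  push_cast
  rfl

/-- Only the combined exponent `L²/N + η C⁻¹ η` is an integer, which is why the outer factor has to
be included. -/
theorem innerLeft_eq_pathWeight {q : ℂ} (hq0 : q ≠ 0) {N : ℕ} (hN : 1 ≤ N) {L : ℤ}
    {K : Fin (N - 1) → ℤ} (hK : K ∈ etaPaths N L) :
    qPow q ((L : ℚ) ^ 2 / N) * innerLeft q N (diffVec K L) = pathWeight q (etaKer q) K L := by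
  rw [innerLeft, ← mul_div_assoc, ← qPow_add hq0, quadForm_diffVec hN hK, qPow_intCast,
    pathWeight, Finset.prod_range, div_eq_mul_inv, ← Finset.prod_inv_distrib]
  congr 1
  refine Finset.prod_congr rfl fun i _ => ?_
  rw [← recPoch_natCast, diffVec_cast hK, etaKer, secondDiff]
  congr 1
  ring

theorem pathWeight_etaKer_eq_zero {q : ℂ} {N : ℕ} {L : ℤ} {K : Fin (N - 1) → ℤ}
    (hK : K ∉ etaPaths N L) : pathWeight q (etaKer q) K L = 0 := by
  simp only [etaPaths, Set.mem_ofPred_eq, not_forall, not_le] at hK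
  obtain ⟨i, hi, h⟩ := hK
  rw [pathWeight, Finset.prod_eq_zero (Finset.mem_range.mpr hi), mul_zero]
  rw [secondDiff] at h
  exact recPoch_neg q (by omega)

theorem tsum_innerLeft {q : ℂ} (hq0 : q ≠ 0) (hq : ‖q‖ < 1) {N : ℕ} (hN : 1 ≤ N) (L : ℤ) :
    qPow q ((L : ℚ) ^ 2 / N) * ∑' η : EtaIndex N L, innerLeft q N η.1 =
      ∑' y, stepWeight q (etaKer q) (N - 1) y L := by
  obtain ⟨C, hC⟩ := exists_norm_etaKer_le hq
  rw [← tsum_pathWeight hq0 hq hC, ← (etaEquiv hN L).tsum_eq, ← tsum_mul_left,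
    ← tsum_subtype_eq_of_support_subset (s := etaPaths N L) fun K hK => by
      by_contra h
      exact hK (pathWeight_etaKer_eq_zero h)]
  exact tsum_congr fun K => innerLeft_eq_pathWeight hq0 hN K.2

theorem qBinom_symm (q : ℂ) (m n : ℕ) : qBinom q (m + n) n = qBinom q (m + n) m := by
  rw [qBinom, qBinom, if_pos (by omega), if_pos (by omega), Nat.add_sub_cancel,
    Nat.add_sub_cancel_left, mul_comm]

theorem innerRight_eq_pathWeight {q : ℂ} (hq0 : q ≠ 0) (hq : ‖q‖ < 1) {N : ℕ} (hN : 1 ≤ N) {L : ℕ}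
    {K : Fin (N - 1) → ℤ} (hK : K ∈ mnPaths N L) :
    qPow q ((L : ℚ) ^ 2 / N) * innerRight q N (fun i => (2 * K i).toNat) (diffVec K L) =
      pathWeight q (binKer q) K L := by
  have h := quadForm_diffVec hN hK.2
  rw [Int.cast_natCast] at h
  rw [innerRight, ← mul_assoc, ← qPow_add hq0, h, qPow_intCast, pathWeight, Finset.prod_range]
  congr 1
  refine Finset.prod_congr rfl fun i _ => ?_
  have h1 : (((2 * K i).toNat : ℕ) : ℤ) = 2 * K i :=
    Int.toNat_of_nonneg (by have := hK.1 i; omega)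
  have h2 := diffVec_cast hK.2 i
  have h3 : pathExt K L (i + 1) = K i := pathExt_succ K L i.2
  have h4 := hK.1 i
  rw [secondDiff, h3] at h2
  -- With lower entry `m_i = 2 K_i` instead of `n_i`, and `m_i + n_i` the sum of the two neighbours
  -- of `K_i`, this is the vertex weight.
  rw [qBinom_symm, ← gauss_natCast hq, binKer, gaussNat, if_pos (by omega), h3]
  push_cast
  rw [h2, h1]
  congr 1
  ring

/-- A nonzero Gaussian binomial at every vertex means that `2 K_i` lies between `0` and the sum of
its neighbours, which is nonnegativity and convexity. The sum may thus run over all integer paths.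
-/
theorem pathWeight_binKer_eq_zero {q : ℂ} (hq : ‖q‖ < 1) {N : ℕ} {L : ℤ} {K : Fin (N - 1) → ℤ}
    (hK : K ∉ mnPaths N L) : pathWeight q (binKer q) K L = 0 := by
  by_contra h
  refine hK ?_
  rw [pathWeight] at h
  have h1 := Finset.prod_ne_zero_iff.mp (right_ne_zero_of_mul h)
  have h2 : ∀ i < N - 1, 0 ≤ 2 * pathExt K L (i + 1) ∧
      2 * pathExt K L (i + 1) ≤ pathExt K L i + pathExt K L (i + 2) := fun i hi => by
    by_contra h3
    exact h1 i (Finset.mem_range.mpr hi) (gaussNat_eq_zero hq h3)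
  refine ⟨fun i => ?_, fun i hi => ?_⟩
  · have := (h2 i i.2).1
    rw [pathExt_succ K L i.2] at this
    simp only [Fin.eta] at this
    omega
  · have := (h2 i hi).2
    rw [secondDiff]
    omega

theorem tsum_innerRight {q : ℂ} (hq0 : q ≠ 0) (hq : ‖q‖ < 1) {N : ℕ} (hN : 1 ≤ N) (L : ℕ) :
    qPow q ((L : ℚ) ^ 2 / N) * ∑' p : MNIndex N L, innerRight q N p.1.1 p.1.2 =
      levelDelta q (N - 1) L := by
  obtain ⟨C, hC⟩ := exists_norm_binKer_le hq
  rw [levelDelta, ← tsum_pathWeight hq0 hq hC, ← (mnEquiv hN L).tsum_eq, ← tsum_mul_left,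
    ← tsum_subtype_eq_of_support_subset (s := mnPaths N L) fun K hK => by
      by_contra h
      exact hK (pathWeight_binKer_eq_zero hq h)]
  exact tsum_congr fun K => innerRight_eq_pathWeight hq0 hq hN K.2

theorem outerLeft_eq {q : ℂ} (hq0 : q ≠ 0) (k N : ℕ) (j : ℤ) :
    outerLeft q k N j = chainAlpha q k j * qPow q ((j : ℚ) ^ 2 / N) := by
  have h : ((2 * k + 1 + 2 / N) * j + 1) * j / 2 =
      ((tri (j + 1) + k * j ^ 2 : ℤ) : ℚ) + (j : ℚ) ^ 2 / N := by
    have h1 : (2 * tri (j + 1) : ℚ) = (j + 1) * j := by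
      have := two_mul_tri (j + 1)
      rw [add_sub_cancel_right] at this
      exact_mod_cast this
    push_cast
    linear_combination (-1 / 2 : ℚ) * h1
  rw [outerLeft, h, qPow_add hq0, qPow_intCast, chainAlpha, mul_assoc]

theorem part_eq {k : ℕ} (r : RIndex (k + 1)) (i : Fin (k + 1)) : part r (i + 1) = r.1 i := by
  simp only [part, Nat.add_sub_cancel, i.2, dite_true, Fin.eta]

theorem part_last {k : ℕ} (r : RIndex k) : part r (k + 1) = 0 := by simp [part]

theorem part_succ_le {k : ℕ} (r : RIndex k) (i : ℕ) : part r (i + 2) ≤ part r (i + 1) := by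
  unfold part
  split_ifs with h1 h2 h3
  · exact r.2 (Fin.mk_le_mk.mpr (by omega))
  · omega
  · exact Nat.zero_le _
  · exact le_rfl

theorem outerRight_eq {q : ℂ} (hq0 : q ≠ 0) (k N : ℕ) (r : RIndex (k + 1)) :
    outerRight q (k + 1) N r =
      qPow q ((part r 1 : ℚ) ^ 2 / N) * chainWeight q k (r.1 0) (Fin.tail r.1) := by
  rw [chainWeight_eq_prod hq0 k r.1 (fun i => part r (i + 1)) (part_eq r) (part_last r)]
  have h1 : Finset.Icc 2 (k + 1) = (Finset.range k).image (· + 2) := by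
    ext i
    simp only [Finset.mem_Icc, Finset.mem_image, Finset.mem_range]
    exact ⟨fun h => ⟨i - 2, by omega, by omega⟩, fun ⟨a, h, h'⟩ => by omega⟩
  have h2 : Finset.Icc 1 (k + 1) = (Finset.range (k + 1)).image (· + 1) := by
    ext i
    simp only [Finset.mem_Icc, Finset.mem_image, Finset.mem_range]
    exact ⟨fun h => ⟨i - 1, by omega, by omega⟩, fun ⟨a, h, h'⟩ => by omega⟩
  have h3 : (∑ i ∈ Finset.Icc 2 (k + 1), (part r i : ℚ) ^ 2) =
      ((∑ i ∈ Finset.range k, (part r (i + 1 + 1) : ℤ) ^ 2 : ℤ) : ℚ) := by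
    rw [h1, Finset.sum_image fun a _ b _ h => by simpa using h]
    push_cast
    rfl
  rw [outerRight, h3, qPow_add hq0, qPow_intCast, mul_div_assoc, h2,
    Finset.prod_image fun a _ b _ h => by simpa using h]
  congr 1
  rw [div_eq_mul_inv, ← Finset.prod_inv_distrib]
  congr 1
  refine Finset.prod_congr rfl fun i _ => ?_
  rw [← Nat.cast_sub (part_succ_le r i), recPoch_natCast]

theorem antitone_of_chainWeight_ne_zero {q : ℂ} (hq0 : q ≠ 0) {k : ℕ} {r : Fin (k + 1) → ℕ}
    (h : chainWeight q k (r 0) (Fin.tail r) ≠ 0) : Antitone r := by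
  rw [chainWeight_eq_prod hq0 k r (fun i => if h : i < k + 1 then r ⟨i, h⟩ else 0)
    (fun i => by simp only [i.2, dite_true, Fin.eta]) (by simp)] at h
  refine Fin.antitone_iff_succ_le.mpr fun i => ?_
  have h1 := Finset.prod_ne_zero_iff.mp (right_ne_zero_of_mul h) i (Finset.mem_range.mpr (by omega))
  rw [dif_pos (by omega : (i : ℕ) < k + 1), dif_pos (by omega : (i : ℕ) + 1 < k + 1)] at h1
  by_contra h2
  refine h1 (recPoch_neg q ?_)
  have : r i.castSucc < r i.succ := not_le.mp h2
  have h3 : r ⟨i, by omega⟩ < r ⟨i + 1, by omega⟩ := this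
  omega

/-! ### Absolute convergence and the identity for `q ≠ 0`. -/

theorem summable_left {q : ℂ} (hq0 : q ≠ 0) (hq : ‖q‖ < 1) (k : ℕ) {N : ℕ} (hN : 1 ≤ N) :
    Summable fun p : (j : ℤ) × EtaIndex N j => outerLeft q k N p.1 * innerLeft q N p.2.1 := by
  obtain ⟨C, hC⟩ := exists_norm_etaKer_le hq
  have h1 : Summable fun p : (Fin (N - 1) → ℤ) × ℤ =>
      chainAlpha q k p.2 * pathWeight q (etaKer q) p.1 p.2 :=
    (summable_norm_pathWeight hq0 hq hC (N - 1)).of_norm_bounded fun p => by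
      rw [norm_mul]
      exact mul_le_of_le_one_left (norm_nonneg _) (norm_chainAlpha_le_one hq k _)
  have h2 : Function.Injective fun p : (j : ℤ) × etaPaths N j => (p.2.1, p.1) := by
    rintro ⟨j, K, hK⟩ ⟨j', K', hK'⟩ h
    simp only [Prod.mk.injEq] at h
    obtain ⟨rfl, rfl⟩ := h
    rfl
  refine (Equiv.sigmaCongrRight (etaEquiv hN)).summable_iff.mp
    ((h1.comp_injective h2).congr ?_)
  rintro ⟨j, K⟩
  change chainAlpha q k j * pathWeight q (etaKer q) K.1 j =
    outerLeft q k N j * innerLeft q N (diffVec K.1 j)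
  rw [← innerLeft_eq_pathWeight hq0 hN K.2, outerLeft_eq hq0]
  ring

theorem summable_right {q : ℂ} (hq0 : q ≠ 0) (hq : ‖q‖ < 1) (k : ℕ) {N : ℕ} (hN : 1 ≤ N) :
    Summable fun p : (r : RIndex (k + 1)) × MNIndex N (part r 1) =>
      outerRight q (k + 1) N p.1 * innerRight q N p.2.1.1 p.2.1.2 := by
  obtain ⟨C, hC⟩ := exists_norm_binKer_le hq
  obtain ⟨g, hg, hg0, hgb⟩ := exists_norm_chainWeight_le hq0 hq k
  have h1 : Summable fun p : ((Fin (N - 1) → ℤ) × ℤ) × (Fin k → ℕ) =>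
      chainWeight q k p.1.2 p.2 * pathWeight q (binKer q) p.1.1 p.1.2 :=
    ((summable_norm_pathWeight hq0 hq hC (N - 1)).mul_of_nonneg hg (fun _ => norm_nonneg _)
      hg0).of_norm_bounded fun p => by
      rw [norm_mul, mul_comm]
      exact mul_le_mul_of_nonneg_left (hgb _ _) (norm_nonneg _)
  have hp : ∀ r : RIndex (k + 1), part r 1 = r.1 0 := fun r => part_eq r 0
  have h2 : Function.Injective fun p : (r : RIndex (k + 1)) × mnPaths N (part r 1 : ℕ) =>
      ((p.2.1, (part p.1 1 : ℤ)), Fin.tail p.1.1) := by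
    rintro ⟨r, K, hK⟩ ⟨r', K', hK'⟩ h
    simp only [Prod.mk.injEq, Nat.cast_inj] at h
    obtain ⟨⟨rfl, h3⟩, h4⟩ := h
    have : r = r' := Subtype.ext (by
      rw [← Fin.cons_self_tail r.1, ← Fin.cons_self_tail r'.1, h4, ← hp, ← hp, h3])
    subst this
    rfl
  refine (Equiv.sigmaCongrRight fun r : RIndex (k + 1) => mnEquiv hN (part r 1)).summable_iff.mp
    ((h1.comp_injective h2).congr ?_)
  rintro ⟨r, K⟩
  change chainWeight q k (part r 1 : ℕ) (Fin.tail r.1) *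
      pathWeight q (binKer q) K.1 (part r 1 : ℕ) =
    outerRight q (k + 1) N r * innerRight q N (fun i => (2 * K.1 i).toNat) (diffVec K.1 _)
  rw [← innerRight_eq_pathWeight hq0 hq hN K.2, outerRight_eq hq0,
    show chainWeight q k (r.1 0 : ℕ) (Fin.tail r.1) = chainWeight q k (part r 1 : ℕ) (Fin.tail r.1) by
      rw [hp]]
  ring

theorem identity_of_ne_zero {q : ℂ} (hq0 : q ≠ 0) (hq : ‖q‖ < 1) (k : ℕ) {N : ℕ} (hN : 1 ≤ N) :
    1 / qPochInf q * ∑' j : ℤ, outerLeft q (k + 1) N j * ∑' η : EtaIndex N j, innerLeft q N η.1 =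
      ∑' r : RIndex (k + 1), outerRight q (k + 1) N r *
        ∑' p : MNIndex N (part r 1), innerRight q N p.1.1 p.1.2 := by
  obtain ⟨g, hg, hg0, hgb⟩ := exists_norm_chainWeight_le hq0 hq k
  let h : (Fin (k + 1) → ℕ) → ℂ := fun r =>
    levelDelta q (N - 1) (r 0) * chainWeight q k (r 0) (Fin.tail r)
  have hs : Summable h := by
    have h1 := ((summable_norm_levelDelta hq0 hq (N - 1)).comp_injective
      (Nat.cast_injective (R := ℤ))).mul_of_nonneg hg (fun _ => norm_nonneg _) hg0
    have h2 : Summable fun p : ℕ × (Fin k → ℕ) =>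
        levelDelta q (N - 1) p.1 * chainWeight q k p.1 p.2 :=
      h1.of_norm_bounded fun p => by
        rw [norm_mul]
        exact mul_le_mul_of_nonneg_left (hgb _ _) (norm_nonneg _)
    refine (Fin.consEquiv fun _ => ℕ).summable_iff.mp (h2.congr ?_)
    rintro ⟨s, r⟩
    simp [Fin.consEquiv, h]
  have hR : ∀ r : RIndex (k + 1), outerRight q (k + 1) N r *
      ∑' p : MNIndex N (part r 1), innerRight q N p.1.1 p.1.2 = h r.1 := fun r => by
    rw [outerRight_eq hq0, mul_right_comm, tsum_innerRight hq0 hq hN]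
    have : part r 1 = r.1 0 := part_eq r 0
    rw [this]
  have hL : ∀ j : ℤ, outerLeft q (k + 1) N j * ∑' η : EtaIndex N j, innerLeft q N η.1 =
      chainAlpha q (k + 1) j * ∑' y, stepWeight q (etaKer q) (N - 1) y j := fun j => by
    rw [outerLeft_eq hq0, mul_assoc, tsum_innerLeft hq0 hq hN]
  rw [tsum_congr hL, tsum_congr hR, one_div, ← tsum_levelDelta_mul_chainBeta hq0 hq]
  -- Sequences that are not decreasing have weight `0`, so the sum extends to all `r` and can be
  -- taken one variable at a time.
  refine Eq.trans ?_ (tsum_subtype_eq_of_support_subset (f := h) (s := {r | Antitone r})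
    fun r hr => antitone_of_chainWeight_ne_zero hq0 (right_ne_zero_of_mul hr)).symm
  rw [tsum_cons hs]
  refine tsum_congr fun s => ?_
  simp only [h, Fin.cons_zero, Fin.tail_cons]
  rw [tsum_mul_left, tsum_chainWeight hq0 hq]

/-! ### The case `q = 0` -/

theorem qPow_zero_left {x : ℚ} (hx : x ≠ 0) : qPow 0 x = 0 :=
  Complex.zero_cpow (by exact_mod_cast hx)

theorem qPow_zero_right (q : ℂ) : qPow q 0 = 1 := by simp [qPow]

theorem qPochInf_zero : qPochInf 0 = 1 := by simp [qPochInf]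

theorem quadForm_zero (N : ℕ) : quadForm N 0 = 0 := by
  have : toRat (0 : Fin (N - 1) → ℕ) = 0 := by ext; simp [toRat]
  rw [quadForm, this, zero_dotProduct]

theorem integralShift_zero (N : ℕ) : IntegralShift N 0 0 := by
  have : toRat (0 : Fin (N - 1) → ℕ) = 0 := by ext; simp [toRat]
  exact ⟨0, by simp [this]⟩

/-- The form is the sum of the squared steps of a path from `0` to `0`; if it vanishes, the path is
constant. -/
theorem eq_zero_of_quadForm_eq_zero {N : ℕ} (hN : 1 ≤ N) {v : Fin (N - 1) → ℕ}
    (hv : IntegralShift N 0 v) (h : quadForm N v = 0) : v = 0 := by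
  obtain ⟨K, hK, rfl⟩ := exists_diffVec_eq hN hv
  have h1 := quadForm_diffVec hN hK
  rw [h, Int.cast_zero, zero_pow two_ne_zero, zero_div, add_zero] at h1
  have h2 : ∑ i ∈ Finset.range (N - 1 + 1), (pathExt K 0 (i + 1) - pathExt K 0 i) ^ 2 = 0 := by
    exact_mod_cast h1.symm
  rw [Finset.sum_eq_zero_iff_of_nonneg fun _ _ => sq_nonneg _] at h2
  ext i
  have hi := i.2
  have h3 := pow_eq_zero_iff two_ne_zero |>.mp (h2 i (Finset.mem_range.mpr (by omega)))
  have h4 := pow_eq_zero_iff two_ne_zero |>.mp (h2 (i + 1) (Finset.mem_range.mpr (by omega)))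
  rw [diffVec, secondDiff]
  simp only [Pi.zero_apply]
  rw [add_assoc] at h4
  norm_num at h4
  omega

theorem outerLeft_zero_left {k N : ℕ} (hk : 1 ≤ k) {j : ℤ} (hj : j ≠ 0) :
    outerLeft 0 k N j = 0 := by
  rw [outerLeft, qPow_zero_left, mul_zero]
  have h1 : (1 : ℚ) ≤ k := by exact_mod_cast hk
  have h2 : (0 : ℚ) ≤ 2 / N := by positivity
  have h3 : (1 : ℚ) ≤ j ^ 2 := by
    have : 1 ≤ j ^ 2 := Order.one_le_iff_pos.mpr (by positivity)
    exact_mod_cast this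
  have h4 : 0 < ((2 * k + 1 + 2 / N) * j + 1) * (j : ℚ) := by
    nlinarith [sq_nonneg ((j : ℚ) + 1), mul_nonneg h2 (sq_nonneg (j : ℚ)),
      mul_nonneg (sub_nonneg.mpr h1) (sq_nonneg (j : ℚ))]
  positivity

theorem innerLeft_zero_left {N : ℕ} (hN : 1 ≤ N) {η : EtaIndex N 0} (hη : η.1 ≠ 0) :
    innerLeft 0 N η.1 = 0 := by
  rw [innerLeft, qPow_zero_left fun h => hη (eq_zero_of_quadForm_eq_zero hN η.2 h), zero_div]

theorem innerRight_zero_left {N : ℕ} (hN : 1 ≤ N) {p : MNIndex N 0} (hp : p.1 ≠ 0) :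
    innerRight 0 N p.1.1 p.1.2 = 0 := by
  by_cases hn : p.1.2 = 0
  · refine (hp (Prod.ext ?_ hn)).elim
    have h0 : ∀ i, pathExt (0 : Fin (N - 1) → ℤ) 0 i = 0 := fun i => by simp [pathExt]
    ext i
    have h := eq_two_mul_of_mnSystem hN p.2.2 (K := 0) (fun i _ => by simp [secondDiff, h0])
      (by rw [hn]; ext i; simp [diffVec, secondDiff, h0]) i
    simpa using h
  · rw [innerRight, qPow_zero_left fun h => hn (eq_zero_of_quadForm_eq_zero hN p.2.1 h), zero_mul]

theorem eq_zero_of_part_one_eq_zero {k : ℕ} {r : RIndex (k + 1)} (h : part r 1 = 0) : r.1 = 0 := by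
  have h0 : r.1 0 = 0 := (part_eq r 0).symm.trans h
  ext i
  have := r.2 (Fin.zero_le i)
  simp only [Pi.zero_apply]
  omega

theorem outerRight_zero_left {k N : ℕ} (hN : 1 ≤ N) {r : RIndex (k + 1)} (h : r.1 ≠ 0) :
    outerRight 0 (k + 1) N r = 0 := by
  have h1 : 0 < (part r 1 : ℚ) := by
    have : part r 1 ≠ 0 := fun h' => h (eq_zero_of_part_one_eq_zero h')
    exact_mod_cast Nat.pos_of_ne_zero this
  have h2 : (0 : ℚ) < N := by exact_mod_cast hN
  rw [outerRight, qPow_zero_left, zero_div]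
  have h3 : 0 ≤ ∑ i ∈ Finset.Icc 2 (k + 1), (part r i : ℚ) ^ 2 :=
    Finset.sum_nonneg fun _ _ => by positivity
  positivity

theorem tsum_innerRight_zero_left {N : ℕ} (hN : 1 ≤ N) :
    ∑' p : MNIndex N 0, innerRight 0 N p.1.1 p.1.2 = 1 := by
  have hr : toRat (0 : Fin (N - 1) → ℕ) = 0 := by ext; simp [toRat]
  let p₀ : MNIndex N 0 := ⟨0, integralShift_zero N, by simp [MNSystem, hr]⟩
  rw [tsum_eq_single p₀]
  · simp [p₀, innerRight, quadForm_zero, qPow_zero_right, qBinom, qPoch]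
  · exact fun p hp => innerRight_zero_left hN fun h => hp (Subtype.ext h)

theorem tsum_innerLeft_zero_left {N : ℕ} (hN : 1 ≤ N) :
    ∑' η : EtaIndex N 0, innerLeft 0 N η.1 = 1 := by
  let η₀ : EtaIndex N 0 := ⟨0, integralShift_zero N⟩
  rw [tsum_eq_single η₀]
  · simp [η₀, innerLeft, quadForm_zero, qPow_zero_right, qPoch]
  · exact fun η hη => innerLeft_zero_left hN fun h => hη (Subtype.ext h)

theorem summable_left_zero {k N : ℕ} (hk : 1 ≤ k) (hN : 1 ≤ N) :
    Summable fun p : (j : ℤ) × EtaIndex N j => outerLeft 0 k N p.1 * innerLeft 0 N p.2.1 := by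
  refine summable_of_hasFiniteSupport (Set.Subsingleton.finite ?_)
  have key : ∀ p : (j : ℤ) × EtaIndex N j, outerLeft 0 k N p.1 * innerLeft 0 N p.2.1 ≠ 0 →
      p = ⟨0, 0, integralShift_zero N⟩ := by
    rintro ⟨j, η⟩ h
    obtain rfl : j = 0 := by
      by_contra hj
      exact h (by rw [outerLeft_zero_left hk hj, zero_mul])
    obtain ⟨η, hη⟩ := η
    obtain rfl : η = 0 := by
      by_contra h'
      exact right_ne_zero_of_mul h (innerLeft_zero_left hN (η := ⟨η, hη⟩) h')
    rfl
  exact fun p hp p' hp' => (key p hp).trans (key p' hp').symm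

theorem summable_right_zero {k N : ℕ} (hN : 1 ≤ N) :
    Summable fun p : (r : RIndex (k + 1)) × MNIndex N (part r 1) =>
      outerRight 0 (k + 1) N p.1 * innerRight 0 N p.2.1.1 p.2.1.2 := by
  have key : ∀ (L : ℕ) (p : MNIndex N L), L = 0 → innerRight 0 N p.1.1 p.1.2 ≠ 0 → p.1 = 0 := by
    rintro L p rfl h
    by_contra h'
    exact h (innerRight_zero_left hN h')
  refine summable_of_hasFiniteSupport (Set.Subsingleton.finite ?_)
  rintro ⟨r, p⟩ h ⟨r', p'⟩ h'
  have hr : r.1 = 0 := by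
    by_contra h1
    exact left_ne_zero_of_mul h (outerRight_zero_left hN h1)
  have hr' : r'.1 = 0 := by
    by_contra h1
    exact left_ne_zero_of_mul h' (outerRight_zero_left hN h1)
  obtain rfl : r = r' := Subtype.ext (hr.trans hr'.symm)
  have h0 : part r 1 = 0 := by rw [show part r 1 = r.1 0 from part_eq r 0, hr]; rfl
  have hp := key _ p h0 (right_ne_zero_of_mul h)
  have hp' := key _ p' h0 (right_ne_zero_of_mul h')
  obtain rfl : p = p' := Subtype.ext (hp.trans hp'.symm)
  rfl

theorem identity_zero {k N : ℕ} (hN : 1 ≤ N) :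
    1 / qPochInf 0 * ∑' j : ℤ, outerLeft 0 (k + 1) N j * ∑' η : EtaIndex N j, innerLeft 0 N η.1 =
      ∑' r : RIndex (k + 1), outerRight 0 (k + 1) N r *
        ∑' p : MNIndex N (part r 1), innerRight 0 N p.1.1 p.1.2 := by
  have key : ∀ L : ℕ, L = 0 → ∑' p : MNIndex N L, innerRight 0 N p.1.1 p.1.2 = 1 := by
    rintro L rfl
    exact tsum_innerRight_zero_left hN
  let r₀ : RIndex (k + 1) := ⟨0, antitone_const⟩
  have hpart : ∀ i, part r₀ i = 0 := fun i => by simp [part, r₀]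
  rw [qPochInf_zero, tsum_eq_single (0 : ℤ) fun j hj => by
      rw [outerLeft_zero_left (by omega) hj, zero_mul], tsum_innerLeft_zero_left hN,
    tsum_eq_single r₀ fun r hr => by
      rw [outerRight_zero_left hN fun h => hr (Subtype.ext h), zero_mul], key _ (hpart 1)]
  simp [outerLeft, outerRight, hpart, qPow_zero_right, qPoch]

end

end HigherBailey

theorem mainTheorem3 (k N : ℕ) (hk : 1 ≤ k) (hN : 1 ≤ N) (q : ℂ) (hq : ‖q‖ < 1) :
    (Summable fun p : (j : ℤ) × HigherBailey.EtaIndex N j =>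
      HigherBailey.outerLeft q k N p.1 * HigherBailey.innerLeft q N p.2.1) ∧
    (Summable fun p : (r : HigherBailey.RIndex k) × HigherBailey.MNIndex N (HigherBailey.part r 1) =>
      HigherBailey.outerRight q k N p.1 * HigherBailey.innerRight q N p.2.1.1 p.2.1.2) ∧
    1 / HigherBailey.qPochInf q *
        ∑' j : ℤ, HigherBailey.outerLeft q k N j *
          ∑' η : HigherBailey.EtaIndex N j, HigherBailey.innerLeft q N η.1 =
      ∑' r : HigherBailey.RIndex k, HigherBailey.outerRight q k N r *
        ∑' p : HigherBailey.MNIndex N (HigherBailey.part r 1),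
          HigherBailey.innerRight q N p.1.1 p.1.2 := by
  obtain ⟨k, rfl⟩ : ∃ k', k = k' + 1 := ⟨k - 1, by omega⟩
  -- At `q = 0` exponents no longer add (`0 ^ x = 0` for every `x ≠ 0`), so the regrouping of powers
  -- is unavailable and this case is computed directly.
  rcases eq_or_ne q 0 with rfl | hq0
  · exact ⟨HigherBailey.summable_left_zero hk hN, HigherBailey.summable_right_zero hN,
      HigherBailey.identity_zero hN⟩
  · exact ⟨HigherBailey.summable_left hq0 hq (k + 1) hN, HigherBailey.summable_right hq0 hq k hN,
      HigherBailey.identity_of_ne_zero hq0 hq k hN⟩
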